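/- Let $d\ge 1$, $w=e^{2\pi i/d}$, and let $\{|s\rangle\}_{s\in\mathbb Z_d}$ be the standard basis of $\mathbb C^d$. For $k,\ell\in\mathbb Z_d$ let $\check W_{k,\ell}|s\rangle=w^{k(s-\ell)}|s-\ell\rangle$, $W_{k,\ell}=\check W_{k,\ell}\otimes\mathbb 1$ on $\mathbb C^d\otimes\mathbb C^d$, $|\Omega_{k,\ell}\rangle=W_{k,\ell}\,\frac1{\sqrt d}\sum_s|s\rangle\otimes|s\rangle$, and $P_{k,\ell}=|\Omega_{k,\ell}\rangle\langle\Omega_{k,\ell}|$. Let $\mathcal W=\{\sum c_{k,\ell}P_{k,\ell} : c_{k,\ell}\ge 0,\ \sum c_{k,\ell}=1\}$, and for a nonempty subset $Q$ of the phase space $\mathbb T=\mathbb Z_d\times\mathbb Z_d$ let $\rho_Q=\frac1{|Q|}\sum_{\alpha\in Q}P_\alpha$. Let SEP be the set of separable states on $\mathbb C^d\otimes\mathbb C^d$ (finite convex combinations of pure product states), LMM the set of density matrices on $\mathbb C^d\otimes\mathbb C^d$ both of whose partial traces equal $\frac1d\mathbb 1$, and $\omega=\frac1{d^2}\mathbb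 1$. An element of a set of states is called maximally exposed in that set if it has the largest distance $\sqrt{\operatorname{Tr}(\sigma-\omega)^2}$ to $\omega$ among the elements of the set. Let $\mathbb W$ be the Heisenberg–Weyl group of all $w^mW_{k,\ell}$, acting on $\mathbb T$ by $gP_xg^\dagger=P_{g\cdot x}$. A line in $\mathbb T$ is a set $\{(p+nk,q+n\ell):n\in\mathbb Z_d\}$, and a sublattice is a translate of a subgroup of $\mathbb Z_d\times\mathbb Z_d$. Then: 1. $Q\mapsto\rho_Q$ is a bijection from the set of all lines and sublattices $Q\subset\mathbb T$ with exactly $d$ points onto the set of maximally exposed elements of $\mathrm{SEP}\cap\mathcal W$. These are exactly the maximally exposed elements of $\mathrm{SEP}\cap\mathrm{LMM}$ which lie in $\mathcal W$. 2. A subset $Q\subset\mathbb T$ with exactly $d$ points is a line or a sublattice if and only if it is the orbit of a point of $\mathbb T$ under an abelian subgroup of $\mathbb W$. 3. If $Q\subset\mathbb T$ has exactly $d$ points and is neither a line nor a sublattice, then there is $\varepsilon_0>0$ such that for all $0<\varepsilon\le\varepsilon_0$ the operator $K=\mathbb 1-(1+\varepsilon)d\rho_Q$ is a nonzero hermitian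 operator with $\operatorname{Tr}(\sigma K)\ge 0$ for all $\sigma\in\mathrm{SEP}$, while $\operatorname{Tr}(\rho_QK)=-\varepsilon<0$; in particular $\rho_Q$ is entangled, i.e. $\rho_Q\notin\mathrm{SEP}$. -/

import Mathlib

open scoped Kronecker Matrix ComplexOrder

namespace MagicSimplex

/-- The classical phase space, with points `(p, q)`: `p` is the momentum, `q` the coordinate. -/
abbrev Phase (d : ℕ) : Type := ZMod d × ZMod d

/-- Operators on `ℂ^d`, written in the preferred basis `|s⟩`, `s ∈ ℤ_d`. -/
abbrev LocalOp (d : ℕ) : Type := Matrix (ZMod d) (ZMod d) ℂ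

/-- Operators on `ℂ^d ⊗ ℂ^d`, written in the preferred basis `|s, t⟩`. -/
abbrev Op (d : ℕ) : Type := Matrix (ZMod d × ZMod d) (ZMod d × ZMod d) ℂ

variable (d : ℕ) [NeZero d]

/-- `w ^ j` for `j ∈ ℤ_d`, where `w = exp (2 π i / d)`. -/
noncomputable def phase (j : ZMod d) : ℂ := ZMod.stdAddChar j

theorem phase_eq_pow (j : ZMod d) :
    phase d j = Complex.exp (2 * Real.pi * Complex.I / d) ^ j.val := by
  have h := ZMod.stdAddChar_coe (N := d) (j.val : ℤ)
  have e : (((j.val : ℕ) : ℤ) : ZMod d) = j := by simp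
  rw [e] at h
  rw [phase, h, ← Complex.exp_nat_mul]
  congr 1
  push_cast
  ring

theorem phase_add (i j : ZMod d) : phase d (i + j) = phase d i * phase d j :=
  AddChar.map_add_eq_mul _ _ _

theorem phase_zero : phase d 0 = 1 := AddChar.map_zero_eq_one _

theorem star_phase (j : ZMod d) : star (phase d j) = phase d (-j) :=
  (AddChar.map_neg_eq_conj _ _).symm

/-- The Weyl operator on the first factor: `|s⟩ ↦ w ^ (k (s - l)) |s - l⟩`. -/
noncomputable def weylLocal (k l : ZMod d) : LocalOp d :=
  Matrix.of fun r s => if r = s - l then phase d (k * (s - l)) else 0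

/-- The Weyl operator on the pair: it acts on the first factor only. -/
noncomputable def weyl (k l : ZMod d) : Op d := weylLocal d k l ⊗ₖ (1 : LocalOp d)

/-- The vector `(1 / √d) ∑ s, |s⟩ ⊗ |s⟩`. -/
noncomputable def omegaVec : ZMod d × ZMod d → ℂ :=
  fun x => if x.1 = x.2 then ((1 / Real.sqrt d : ℝ) : ℂ) else 0

/-- The Bell state vector at a point of the phase space. -/
noncomputable def bellVec (x : Phase d) : ZMod d × ZMod d → ℂ :=
  weyl d x.1 x.2 *ᵥ omegaVec d

/-- The Bell state at a point of the phase space, `|Ω⟩⟨Ω|`. -/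
noncomputable def bell (x : Phase d) : Op d :=
  Matrix.vecMulVec (bellVec d x) (star (bellVec d x))

/-- The magic simplex. -/
def magicSimplex : Set (Op d) :=
  {σ | ∃ c : Phase d → ℝ, (∀ x, 0 ≤ c x) ∧ ∑ x, c x = 1 ∧ σ = ∑ x, (c x : ℂ) • bell d x}

/-- The equidistribution `ρ_Q` over a set of phase space points. -/
noncomputable def rho (Q : Finset (Phase d)) : Op d :=
  (1 / (Q.card : ℂ)) • ∑ x ∈ Q, bell d x

/-- The product vector `φ ⊗ ψ`. -/
def prodVec (φ ψ : ZMod d → ℂ) : ZMod d × ZMod d → ℂ := fun x => φ x.1 * ψ x.2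

/-- The separable states: the finite mixtures of the pure product states. -/
def SEP : Set (Op d) :=
  convexHull ℝ {σ | ∃ φ ψ : ZMod d → ℂ, ∑ s, ‖φ s‖ ^ 2 = 1 ∧ ∑ s, ‖ψ s‖ ^ 2 = 1 ∧
    σ = Matrix.vecMulVec (prodVec d φ ψ) (star (prodVec d φ ψ))}

/-- The partial trace over the second factor. -/
def partialTraceB (σ : Op d) : LocalOp d := Matrix.of fun r s => ∑ t, σ (r, t) (s, t)

/-- The partial trace over the first factor. -/
def partialTraceA (σ : Op d) : LocalOp d := Matrix.of fun r s => ∑ t, σ (t, r) (t, s)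

/-- The locally maximally mixed states. -/
def LMM : Set (Op d) :=
  {σ | σ.PosSemidef ∧ σ.trace = 1 ∧
    partialTraceB d σ = (1 / (d : ℂ)) • (1 : LocalOp d) ∧
    partialTraceA d σ = (1 / (d : ℂ)) • (1 : LocalOp d)}

/-- The global maximally mixed state. -/
noncomputable def maxMixed : Op d := (1 / (d : ℂ) ^ 2) • (1 : Op d)

/-- The distance `√(Tr (A - B)²)`, used for hermitian matrices. -/
noncomputable def hsDist (A B : Op d) : ℝ := Real.sqrt (((A - B) * (A - B)).trace).re

/-- The maximally exposed elements of a set of states: those which have the largest distance to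
the maximally mixed state. -/
def maximallyExposed (S : Set (Op d)) : Set (Op d) :=
  {σ | σ ∈ S ∧ ∀ τ ∈ S, hsDist d τ (maxMixed d) ≤ hsDist d σ (maxMixed d)}

/-- Structural witnesses: nonzero hermitian operators with a non-negative expectation in every
separable state. -/
def structuralWitness : Set (Op d) :=
  {K | K.IsHermitian ∧ K ≠ 0 ∧ ∀ σ ∈ SEP d, 0 ≤ ((σ * K).trace).re}

/-- A line in the phase space: `{(p + n k, q + n l)}`, with `n` running through `ℤ_d`. -/
def IsLine (Q : Finset (Phase d)) : Prop :=
  ∃ p q k l : ZMod d, (Q : Set (Phase d)) = {y | ∃ n : ZMod d, y = (p + n * k, q + n * l)}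

/-- A (not necessarily centred) sublattice of the phase space: a translate of a subgroup. -/
def IsSublattice (Q : Finset (Phase d)) : Prop :=
  ∃ (x : Phase d) (H : AddSubgroup (Phase d)), (Q : Set (Phase d)) = {y | ∃ h ∈ H, y = x + h}

/-- The lines and sublattices with exactly `d` points. -/
def linesAndSublattices : Set (Finset (Phase d)) :=
  {Q | Q.card = d ∧ (IsLine d Q ∨ IsSublattice d Q)}

theorem weylLocal_mul (j l k m : ZMod d) :
    weylLocal d j l * weylLocal d k m = phase d (k * l) • weylLocal d (j + k) (l + m) := by
  ext r s
  simp only [weylLocal, Matrix.mul_apply, Matrix.of_apply, Matrix.smul_apply, smul_eq_mul]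
  rw [Finset.sum_eq_single (s - m)]
  · have e : s - (l + m) = s - m - l := by ring
    rw [e]
    by_cases h : r = s - m - l
    · simp only [h, if_true]
      rw [← phase_add, ← phase_add]
      congr 1
      ring
    · simp [h]
  · intro b _ hb
    simp [hb]
  · simp

theorem weylLocal_zero : weylLocal d 0 0 = 1 := by
  ext r s
  simp [weylLocal, Matrix.one_apply, phase_zero]

theorem weylLocal_conjTranspose (k l : ZMod d) :
    (weylLocal d k l)ᴴ = phase d (k * l) • weylLocal d (-k) (-l) := by
  ext r s
  simp only [weylLocal, Matrix.conjTranspose_apply, Matrix.of_apply, Matrix.smul_apply,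
    smul_eq_mul]
  by_cases h : s = r - l
  · have h' : r = s - -l := by rw [h]; ring
    rw [if_pos h, if_pos h', star_phase, ← phase_add]
    congr 1
    rw [h]
    ring
  · have h' : ¬ r = s - -l := fun h' => h (by rw [h']; ring)
    rw [if_neg h, if_neg h']
    simp

theorem weyl_mul (j l k m : ZMod d) :
    weyl d j l * weyl d k m = phase d (k * l) • weyl d (j + k) (l + m) := by
  rw [weyl, weyl, weyl, ← Matrix.mul_kronecker_mul, weylLocal_mul, one_mul,
    Matrix.smul_kronecker]

theorem weyl_zero : weyl d 0 0 = 1 := by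
  rw [weyl, weylLocal_zero, Matrix.one_kronecker_one]

theorem weyl_conjTranspose (k l : ZMod d) :
    (weyl d k l)ᴴ = phase d (k * l) • weyl d (-k) (-l) := by
  rw [weyl, weyl, Matrix.conjTranspose_kronecker, weylLocal_conjTranspose,
    Matrix.conjTranspose_one, Matrix.smul_kronecker]

/-- The Heisenberg-Weyl group, with the elements `w ^ m W_{k,l}`, as a group of unitary
operators on `ℂ^d ⊗ ℂ^d`. -/
def heisenbergWeyl : Subgroup (Matrix.unitaryGroup (ZMod d × ZMod d) ℂ) where
  carrier := {g | ∃ m k l : ZMod d, (g : Op d) = phase d m • weyl d k l}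
  mul_mem' := by
    rintro a b ⟨m, k, l, ha⟩ ⟨m', k', l', hb⟩
    refine ⟨m + m' + k' * l, k + k', l + l', ?_⟩
    rw [Matrix.UnitaryGroup.mul_val, ha, hb, Matrix.smul_mul, Matrix.mul_smul, weyl_mul,
      smul_smul, smul_smul, phase_add, phase_add, mul_assoc]
  one_mem' := ⟨0, 0, 0, by rw [phase_zero, weyl_zero, one_smul]; rfl⟩
  inv_mem' := by
    rintro a ⟨m, k, l, ha⟩
    refine ⟨-m + k * l, -k, -l, ?_⟩
    rw [Matrix.UnitaryGroup.inv_val, ha, Matrix.star_eq_conjTranspose, Matrix.conjTranspose_smul,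
      weyl_conjTranspose, star_phase, smul_smul, phase_add]

/-- The orbit of a phase space point under a group of unitary operators: a point `x` is identified
with the Bell state there, on which a unitary operator `g` acts by `P ↦ g P g†`. -/
def orbit (G : Subgroup (Matrix.unitaryGroup (ZMod d × ZMod d) ℂ)) (x : Phase d) :
    Set (Phase d) :=
  {y | ∃ g ∈ G, (g : Op d) * bell d x * (g : Op d)ᴴ = bell d y}

/-- The set `Q` is generated from one of its points by an abelian subgroup of the
Heisenberg-Weyl group. -/
def IsGeneratedByAbelian (Q : Finset (Phase d)) : Prop :=
  ∃ (x : Phase d) (G : Subgroup (Matrix.unitaryGroup (ZMod d × ZMod d) ℂ)),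
    G ≤ heisenbergWeyl d ∧ (∀ g ∈ G, ∀ h ∈ G, g * h = h * g) ∧ (Q : Set (Phase d)) = orbit d G x

end MagicSimplex

/-!
The amplitude of a product vector in a Bell state is an overlap of vectors of one factor,
`⟨Ω_x | φ ⊗ ψ⟩ = ⟨W_x ψ̄ | φ⟩ / √d` (`amplitude_eq`). By the Cauchy-Schwarz inequality its squared
modulus is at most `1 / d`, with equality exactly if `φ` is proportional to `W_x ψ̄`
(`norm_sq_amplitude_eq_iff`).

*Purity.* By the reduction criterion (`posSemidef_reduction`), a separable state `σ` with maximally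
mixed marginals satisfies `σ ≤ 1 / d`, so `Tr σ² ≤ 1 / d` (`purity_le`); the distance to the
maximally mixed state is a function of the purity. For `σ = ∑ c_x P_x` in the magic simplex the same
inequality says `c_x ≤ 1 / d`, and `∑ c_x² = 1 / d` forces `c_x ∈ {0, 1 / d}`, that is, `σ = ρ_Q`
with `|Q| = d` (`exists_eq_rho_of_purity`).

*Sublattices give separable states.* A line is a translate of a cyclic subgroup, so only translates
`x₀ + H` of subgroups with `d` elements matter. On such an `H` the symplectic form vanishes
(`symplectic_eq_zero`), hence the Weyl operators of `H` commute and have a common unit eigenvector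
`v`. The product vector `W_{x₀} v ⊗ v̄` has the maximal overlap `1 / d` with each of the `d` Bell states
of `x₀ + H`, and therefore none with the others. Averaging it over the unitaries `W_y ⊗ W̄_y` yields
its Bell-diagonal part (`twirl`), which is `ρ_Q`.

*Other sets give entangled states.* By compactness the expectation of `d ρ_Q` over separable states
is bounded by its value at some product vector `φ ⊗ ψ`. This value is a sum of `d` terms, each at
most `1 / d`; if it is `1`, then `ψ̄` is an eigenvector of `W_{x - y}` for all `x, y ∈ Q`. The points
whose Weyl operator has `ψ̄` as an eigenvector form a subgroup with at most `d` elements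
(`card_eigenSubgroup_le`), since the overlaps with all Bell states add up to `1`. So `Q` is a
translate of this subgroup. For any other `Q` the bound is smaller than `1`
(`exists_bound_lt_one`), which leaves room for the witnesses.

*Orbits.* A Heisenberg-Weyl operator `w ^ m W_{k,l}` translates the phase space by `(k, l)`, so orbits
are translates of subgroups; conversely the operators over an isotropic subgroup commute.
-/

namespace MagicSimplex

variable {d : ℕ} [NeZero d]

/-! ### Weyl operators and the Bell basis -/

theorem dim_ne_zero : (d : ℂ) ≠ 0 := Nat.cast_ne_zero.mpr (NeZero.ne d)

theorem dim_pos : (0 : ℝ) < d := Nat.cast_pos.mpr (NeZero.pos d)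

theorem phase_mul_phase_neg (j : ZMod d) : phase d j * phase d (-j) = 1 := by
  rw [← phase_add, add_neg_cancel, phase_zero]

theorem sum_phase_mul (b : ZMod d) : ∑ x, phase d (x * b) = if b = 0 then (d : ℂ) else 0 := by
  have h := AddChar.sum_mulShift b (ZMod.isPrimitive_stdAddChar d)
  rw [ZMod.card] at h
  exact_mod_cast h

theorem conjTranspose_weylLocal_mul_self (k l : ZMod d) :
    (weylLocal d k l)ᴴ * weylLocal d k l = 1 := by
  rw [weylLocal_conjTranspose, Matrix.smul_mul, weylLocal_mul, smul_smul, ← phase_add]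
  simp [weylLocal_zero, phase_zero]

theorem weylLocal_mul_conjTranspose_self (k l : ZMod d) :
    weylLocal d k l * (weylLocal d k l)ᴴ = 1 :=
  mul_eq_one_comm.mp (conjTranspose_weylLocal_mul_self k l)

theorem trace_weylLocal (k l : ZMod d) :
    (weylLocal d k l).trace = if k = 0 ∧ l = 0 then (d : ℂ) else 0 := by
  by_cases hl : l = 0
  · simp only [Matrix.trace, Matrix.diag, weylLocal, Matrix.of_apply, hl, sub_zero, if_true,
      and_true]
    simp_rw [mul_comm k]
    exact sum_phase_mul k
  · have h (i : ZMod d) : i ≠ i - l := fun h => hl (by simpa using h.symm)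
    simp [Matrix.trace, weylLocal, hl, h]

theorem trace_conjTranspose_weylLocal_mul (x y : Phase d) :
    ((weylLocal d x.1 x.2)ᴴ * weylLocal d y.1 y.2).trace = if x = y then (d : ℂ) else 0 := by
  by_cases h : x = y
  · subst h
    simp [conjTranspose_weylLocal_mul_self]
  · rw [weylLocal_conjTranspose, Matrix.smul_mul, weylLocal_mul, Matrix.trace_smul,
      Matrix.trace_smul, trace_weylLocal, if_neg h, if_neg]
    · simp
    · rintro ⟨h1, h2⟩
      exact h (Prod.ext (neg_add_eq_zero.mp h1) (neg_add_eq_zero.mp h2))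

theorem bellVec_apply (x : Phase d) (r t : ZMod d) :
    bellVec d x (r, t) = ((1 / Real.sqrt d : ℝ) : ℂ) * weylLocal d x.1 x.2 r t := by
  rw [bellVec, weyl, Matrix.mulVec, dotProduct, Fintype.sum_prod_type]
  simp only [omegaVec, Matrix.kroneckerMap_apply, mul_ite, mul_zero, Finset.sum_ite_eq,
    Finset.mem_univ, if_true, Matrix.one_apply, mul_one, ite_mul, zero_mul]
  rw [mul_comm]

theorem inv_sqrt_mul_self :
    ((1 / Real.sqrt d : ℝ) : ℂ) * ((1 / Real.sqrt d : ℝ) : ℂ) = 1 / (d : ℂ) := by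
  rw [← Complex.ofReal_mul, div_mul_div_comm, Real.mul_self_sqrt dim_pos.le]
  simp

theorem star_bellVec_dotProduct_bellVec (x y : Phase d) :
    star (bellVec d x) ⬝ᵥ bellVec d y = if x = y then 1 else 0 := by
  have h : star (bellVec d x) ⬝ᵥ bellVec d y =
      1 / (d : ℂ) * ((weylLocal d x.1 x.2)ᴴ * weylLocal d y.1 y.2).trace := by
    rw [dotProduct, Fintype.sum_prod_type, Finset.sum_comm, Matrix.trace, Finset.mul_sum]
    refine Finset.sum_congr rfl fun t _ => ?_
    rw [Matrix.diag_apply, Matrix.mul_apply, Finset.mul_sum]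
    refine Finset.sum_congr rfl fun r _ => ?_
    rw [Pi.star_apply, bellVec_apply, bellVec_apply, star_mul', ← inv_sqrt_mul_self,
      Matrix.conjTranspose_apply, Complex.star_def, Complex.conj_ofReal]
    ring
  rw [h, trace_conjTranspose_weylLocal_mul]
  split_ifs
  · exact one_div_mul_cancel dim_ne_zero
  · simp

/-- The `d²` Bell states are a complete orthonormal system. -/
theorem sum_bell : ∑ x, bell d x = 1 := by
  let U : Op d := Matrix.of fun s x => bellVec d x s
  have hU : Uᴴ * U = 1 := by
    ext x y
    simpa [U, Matrix.mul_apply, Matrix.one_apply, dotProduct] using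
      star_bellVec_dotProduct_bellVec x y
  rw [← mul_eq_one_comm.mp hU]
  ext r s
  simp [U, Matrix.mul_apply, bell, Matrix.vecMulVec_apply, Matrix.sum_apply]

theorem bell_mul_bell (x y : Phase d) :
    bell d x * bell d y = if x = y then bell d x else 0 := by
  rw [bell, bell, Matrix.vecMulVec_mul_vecMulVec, star_bellVec_dotProduct_bellVec]
  split_ifs with h
  · rw [h, one_smul]
  · rw [zero_smul, Matrix.vecMulVec_zero]

theorem trace_bell (x : Phase d) : (bell d x).trace = 1 := by
  rw [bell, Matrix.trace_vecMulVec, dotProduct_comm, star_bellVec_dotProduct_bellVec, if_pos rfl]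

theorem star_bellVec_dotProduct_bell_mulVec (x y : Phase d) :
    star (bellVec d x) ⬝ᵥ (bell d y *ᵥ bellVec d x) = if x = y then 1 else 0 := by
  rw [bell, Matrix.vecMulVec_mulVec, star_bellVec_dotProduct_bellVec]
  by_cases h : x = y
  · simp [h, star_bellVec_dotProduct_bellVec]
  · simp [h, Ne.symm h]

theorem bell_injective : Function.Injective (bell d) := by
  intro x y h
  have h1 := star_bellVec_dotProduct_bell_mulVec x y
  rw [← h, star_bellVec_dotProduct_bell_mulVec, if_pos rfl] at h1
  by_contra hne
  simp [hne] at h1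

theorem vecMulVec_smul_star_smul {n : Type*} (c : ℂ) (v : n → ℂ) :
    Matrix.vecMulVec (c • v) (star (c • v)) = (‖c‖ ^ 2 : ℝ) • Matrix.vecMulVec v (star v) := by
  ext i j
  simp only [Matrix.vecMulVec_apply, Pi.smul_apply, Pi.star_apply, smul_eq_mul, star_mul',
    Matrix.smul_apply, Complex.real_smul]
  push_cast
  rw [← Complex.mul_conj', Complex.star_def]
  ring

/-! ### Unit vectors -/

theorem star_dotProduct_self {n : Type*} [Fintype n] (v : n → ℂ) :
    star v ⬝ᵥ v = ((∑ s, ‖v s‖ ^ 2 : ℝ) : ℂ) := by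
  simp [dotProduct, Complex.conj_mul']

theorem sum_norm_sq_eq_one_iff {n : Type*} [Fintype n] (v : n → ℂ) :
    ∑ s, ‖v s‖ ^ 2 = 1 ↔ star v ⬝ᵥ v = 1 := by
  rw [star_dotProduct_self]
  exact_mod_cast Iff.rfl

theorem star_mulVec_dotProduct_mulVec {n : Type*} [Fintype n] [DecidableEq n]
    {U : Matrix n n ℂ} (hU : Uᴴ * U = 1) (v w : n → ℂ) :
    star (U *ᵥ v) ⬝ᵥ (U *ᵥ w) = star v ⬝ᵥ w := by
  rw [Matrix.star_mulVec, ← Matrix.dotProduct_mulVec, Matrix.mulVec_mulVec, hU, Matrix.one_mulVec]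

/-- The squared length of the component of a unit vector `w` orthogonal to a unit vector `v`. -/
theorem sum_norm_sq_sub_smul {n : Type*} [Fintype n] {v w : n → ℂ} (hv : star v ⬝ᵥ v = 1)
    (hw : star w ⬝ᵥ w = 1) :
    ∑ s, ‖(w - (star v ⬝ᵥ w) • v) s‖ ^ 2 = 1 - ‖star v ⬝ᵥ w‖ ^ 2 := by
  have h := star_dotProduct_self (w - (star v ⬝ᵥ w) • v)
  have hc : star w ⬝ᵥ v = star (star v ⬝ᵥ w) := by
    rw [Matrix.star_dotProduct]
  rw [star_sub, star_smul, sub_dotProduct, dotProduct_sub, dotProduct_sub, smul_dotProduct,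
    smul_dotProduct, dotProduct_smul, dotProduct_smul, hv, hw, hc] at h
  apply Complex.ofReal_injective
  rw [← h]
  push_cast
  rw [← Complex.mul_conj', Complex.star_def]
  simp only [smul_eq_mul]
  ring

theorem norm_sq_star_dotProduct_le_one {n : Type*} [Fintype n] {v w : n → ℂ}
    (hv : star v ⬝ᵥ v = 1) (hw : star w ⬝ᵥ w = 1) : ‖star v ⬝ᵥ w‖ ^ 2 ≤ 1 := by
  have h := sum_norm_sq_sub_smul hv hw
  have h' : 0 ≤ ∑ s, ‖(w - (star v ⬝ᵥ w) • v) s‖ ^ 2 := by positivity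
  linarith

/-- The case of equality in the Cauchy-Schwarz inequality. -/
theorem eq_smul_of_norm_sq_star_dotProduct {n : Type*} [Fintype n] {v w : n → ℂ}
    (hv : star v ⬝ᵥ v = 1) (hw : star w ⬝ᵥ w = 1) (h : ‖star v ⬝ᵥ w‖ ^ 2 = 1) :
    w = (star v ⬝ᵥ w) • v := by
  have h0 := sum_norm_sq_sub_smul hv hw
  rw [h, sub_self, Finset.sum_eq_zero_iff_of_nonneg fun _ _ => by positivity] at h0
  funext s
  have := h0 s (Finset.mem_univ s)
  rwa [sq_eq_zero_iff, norm_eq_zero, Pi.sub_apply, sub_eq_zero] at this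

theorem norm_eq_one_of_smul {n : Type*} [Fintype n] {v w : n → ℂ} {c : ℂ}
    (hv : star v ⬝ᵥ v = 1) (hw : star w ⬝ᵥ w = 1) (h : w = c • v) : ‖c‖ = 1 := by
  rw [h, star_smul, smul_dotProduct, dotProduct_smul, hv, smul_eq_mul, smul_eq_mul, mul_one,
    Complex.star_def, Complex.conj_mul'] at hw
  have h2 : ‖c‖ ^ 2 = 1 := by exact_mod_cast hw
  exact (pow_eq_one_iff_of_nonneg (norm_nonneg c) two_ne_zero).mp h2

/-! ### Amplitudes of product vectors in the Bell basis -/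

/-- The amplitude `⟨Ω_x | φ ⊗ ψ⟩` of a product vector at a phase space point `x`. -/
noncomputable def amplitude (x : Phase d) (φ ψ : ZMod d → ℂ) : ℂ :=
  star (bellVec d x) ⬝ᵥ prodVec d φ ψ

/-- `⟨Ω_x | φ ⊗ ψ⟩ = ⟨W_x ψ̄ | φ⟩ / √d`: the overlap with a Bell state is an overlap of vectors
of one factor. -/
theorem amplitude_eq (x : Phase d) (φ ψ : ZMod d → ℂ) :
    amplitude x φ ψ =
      ((1 / Real.sqrt d : ℝ) : ℂ) * (star (weylLocal d x.1 x.2 *ᵥ star ψ) ⬝ᵥ φ) := by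
  rw [amplitude, dotProduct, dotProduct, Fintype.sum_prod_type, Finset.mul_sum]
  refine Finset.sum_congr rfl fun r _ => ?_
  rw [Pi.star_apply, Matrix.mulVec, dotProduct, star_sum, Finset.sum_mul, Finset.mul_sum]
  refine Finset.sum_congr rfl fun t _ => ?_
  rw [Pi.star_apply, bellVec_apply, star_mul', star_mul', Pi.star_apply, star_star, prodVec,
    Complex.star_def, Complex.conj_ofReal]
  ring

theorem norm_sq_amplitude (x : Phase d) (φ ψ : ZMod d → ℂ) :
    ‖amplitude x φ ψ‖ ^ 2 = 1 / d * ‖star (weylLocal d x.1 x.2 *ᵥ star ψ) ⬝ᵥ φ‖ ^ 2 := by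
  rw [amplitude_eq, norm_mul, mul_pow, Complex.norm_real, Real.norm_eq_abs, sq_abs, div_pow,
    Real.sq_sqrt dim_pos.le, one_pow]

theorem star_prodVec_dotProduct_self {φ ψ : ZMod d → ℂ} (hφ : star φ ⬝ᵥ φ = 1)
    (hψ : star ψ ⬝ᵥ ψ = 1) : star (prodVec d φ ψ) ⬝ᵥ prodVec d φ ψ = 1 := by
  rw [← one_mul (1 : ℂ)]
  nth_rw 1 [← hφ]
  rw [← hψ, dotProduct, dotProduct, dotProduct, Fintype.sum_prod_type, Finset.sum_mul_sum]
  refine Finset.sum_congr rfl fun r _ => Finset.sum_congr rfl fun t _ => ?_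
  simp only [Pi.star_apply, prodVec, star_mul']
  ring

theorem prodVec_eq_sum (φ ψ : ZMod d → ℂ) :
    prodVec d φ ψ = ∑ x, amplitude x φ ψ • bellVec d x := by
  conv_lhs => rw [← Matrix.one_mulVec (prodVec d φ ψ), ← sum_bell, Matrix.sum_mulVec]
  refine Finset.sum_congr rfl fun x _ => ?_
  rw [bell, Matrix.vecMulVec_mulVec]
  simp [amplitude]

theorem trace_bell_mul_vecMulVec (x : Phase d) (φ ψ : ZMod d → ℂ) :
    (Matrix.vecMulVec (prodVec d φ ψ) (star (prodVec d φ ψ)) * bell d x).trace =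
      ((‖amplitude x φ ψ‖ ^ 2 : ℝ) : ℂ) := by
  rw [bell, Matrix.vecMulVec_mul_vecMulVec, Matrix.trace_vecMulVec, dotProduct_smul, smul_eq_mul]
  have h : star (prodVec d φ ψ) ⬝ᵥ bellVec d x = star (amplitude x φ ψ) := by
    rw [amplitude, Matrix.star_dotProduct]
  rw [h, dotProduct_comm]
  push_cast
  rw [← Complex.conj_mul', Complex.star_def, amplitude]

theorem sum_norm_sq_amplitude {φ ψ : ZMod d → ℂ} (hφ : star φ ⬝ᵥ φ = 1)
    (hψ : star ψ ⬝ᵥ ψ = 1) : ∑ x, ‖amplitude x φ ψ‖ ^ 2 = 1 := by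
  apply Complex.ofReal_injective
  rw [Complex.ofReal_sum]
  simp_rw [← trace_bell_mul_vecMulVec]
  rw [← Matrix.trace_sum, ← Finset.mul_sum, sum_bell, mul_one, Matrix.trace_vecMulVec,
    dotProduct_comm, star_prodVec_dotProduct_self hφ hψ, Complex.ofReal_one]

theorem star_star_dotProduct_star {ψ : ZMod d → ℂ} (hψ : star ψ ⬝ᵥ ψ = 1) :
    star (star ψ) ⬝ᵥ star ψ = 1 := by
  rw [star_star, dotProduct_comm, hψ]

theorem star_weylLocal_mulVec_dotProduct_self (x : Phase d) {v : ZMod d → ℂ}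
    (hv : star v ⬝ᵥ v = 1) :
    star (weylLocal d x.1 x.2 *ᵥ v) ⬝ᵥ (weylLocal d x.1 x.2 *ᵥ v) = 1 := by
  rw [star_mulVec_dotProduct_mulVec (conjTranspose_weylLocal_mul_self _ _), hv]

theorem norm_sq_amplitude_le (x : Phase d) {φ ψ : ZMod d → ℂ} (hφ : star φ ⬝ᵥ φ = 1)
    (hψ : star ψ ⬝ᵥ ψ = 1) : ‖amplitude x φ ψ‖ ^ 2 ≤ 1 / d := by
  rw [norm_sq_amplitude]
  refine mul_le_of_le_one_right (by positivity) ?_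
  exact norm_sq_star_dotProduct_le_one
    (star_weylLocal_mulVec_dotProduct_self x (star_star_dotProduct_star hψ)) hφ

/-- The amplitude has its largest modulus exactly at those `x` for which `φ` and `W_x ψ̄` are
proportional. -/
theorem norm_sq_amplitude_eq_iff (x : Phase d) {φ ψ : ZMod d → ℂ} (hφ : star φ ⬝ᵥ φ = 1)
    (hψ : star ψ ⬝ᵥ ψ = 1) :
    ‖amplitude x φ ψ‖ ^ 2 = 1 / d ↔ ∃ c : ℂ, φ = c • (weylLocal d x.1 x.2 *ᵥ star ψ) := by
  have hv := star_weylLocal_mulVec_dotProduct_self x (star_star_dotProduct_star hψ)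
  rw [norm_sq_amplitude, mul_eq_left₀ (by have := dim_pos (d := d); positivity)]
  constructor
  · intro h
    exact ⟨_, eq_smul_of_norm_sq_star_dotProduct hv hφ h⟩
  · rintro ⟨c, hc⟩
    have h1 := norm_eq_one_of_smul hv hφ hc
    rw [hc, dotProduct_smul, hv, smul_eq_mul, mul_one, h1, one_pow]

/-! ### Purity and the reduction criterion -/

theorem partialTraceB_bell (x : Phase d) : partialTraceB d (bell d x) = (1 / (d : ℂ)) • 1 := by
  rw [← weylLocal_mul_conjTranspose_self x.1 x.2]
  ext r s
  rw [partialTraceB, Matrix.of_apply, Matrix.smul_apply, Matrix.mul_apply, Finset.smul_sum]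
  refine Finset.sum_congr rfl fun t _ => ?_
  rw [bell, Matrix.vecMulVec_apply, Pi.star_apply, bellVec_apply, bellVec_apply, star_mul',
    Complex.star_def, Complex.conj_ofReal, ← inv_sqrt_mul_self, Matrix.conjTranspose_apply,
    smul_eq_mul, Complex.star_def]
  ring

theorem partialTraceA_bell (x : Phase d) : partialTraceA d (bell d x) = (1 / (d : ℂ)) • 1 := by
  rw [← Matrix.transpose_one, ← conjTranspose_weylLocal_mul_self x.1 x.2]
  ext r s
  rw [partialTraceA, Matrix.of_apply, Matrix.smul_apply, Matrix.transpose_apply, Matrix.mul_apply,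
    Finset.smul_sum]
  refine Finset.sum_congr rfl fun t _ => ?_
  rw [bell, Matrix.vecMulVec_apply, Pi.star_apply, bellVec_apply, bellVec_apply, star_mul',
    Complex.star_def, Complex.conj_ofReal, ← inv_sqrt_mul_self, Matrix.conjTranspose_apply,
    smul_eq_mul, Complex.star_def]
  ring

theorem partialTraceB_sum_smul {ι : Type*} (t : Finset ι) (c : ι → ℂ) (σ : ι → Op d) :
    partialTraceB d (∑ i ∈ t, c i • σ i) = ∑ i ∈ t, c i • partialTraceB d (σ i) := by
  ext r s
  simp only [partialTraceB, Matrix.of_apply, Matrix.sum_apply, Matrix.smul_apply, Finset.smul_sum]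
  exact Finset.sum_comm

theorem partialTraceA_sum_smul {ι : Type*} (t : Finset ι) (c : ι → ℂ) (σ : ι → Op d) :
    partialTraceA d (∑ i ∈ t, c i • σ i) = ∑ i ∈ t, c i • partialTraceA d (σ i) := by
  ext r s
  simp only [partialTraceA, Matrix.of_apply, Matrix.sum_apply, Matrix.smul_apply, Finset.smul_sum]
  exact Finset.sum_comm

theorem magicSimplex_subset_LMM : magicSimplex d ⊆ LMM d := by
  rintro σ ⟨c, hc, hsum, rfl⟩
  have hs : ∑ x, (c x : ℂ) = 1 := by exact_mod_cast hsum
  refine ⟨?_, ?_, ?_, ?_⟩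
  · refine Matrix.posSemidef_sum _ fun x _ => ?_
    exact (Matrix.posSemidef_vecMulVec_self_star _).smul (by exact_mod_cast hc x)
  · simp [Matrix.trace_sum, trace_bell, hs]
  · rw [partialTraceB_sum_smul]
    simp_rw [partialTraceB_bell]
    rw [← Finset.sum_smul, hs, one_smul]
  · rw [partialTraceA_sum_smul]
    simp_rw [partialTraceA_bell]
    rw [← Finset.sum_smul, hs, one_smul]

theorem trace_sum_smul_bell_mul_self (c : Phase d → ℝ) :
    ((∑ x, (c x : ℂ) • bell d x) * ∑ x, (c x : ℂ) • bell d x).trace = ((∑ x, c x ^ 2 : ℝ) : ℂ) := by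
  rw [Finset.sum_mul_sum, Matrix.trace_sum, Complex.ofReal_sum]
  refine Finset.sum_congr rfl fun x _ => ?_
  simp_rw [Matrix.smul_mul, Matrix.mul_smul, bell_mul_bell]
  simp [trace_bell, sq]

theorem star_bellVec_dotProduct_sum_mulVec (c : Phase d → ℝ) (x : Phase d) :
    star (bellVec d x) ⬝ᵥ ((∑ y, (c y : ℂ) • bell d y) *ᵥ bellVec d x) = c x := by
  simp [Matrix.sum_mulVec, Matrix.smul_mulVec, dotProduct_sum,
    star_bellVec_dotProduct_bell_mulVec]

theorem trace_sub_maxMixed_mul_self {σ : Op d} (hσ : σ.trace = 1) :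
    ((σ - maxMixed d) * (σ - maxMixed d)).trace =
      (σ * σ).trace - ((1 / (d : ℝ) ^ 2 : ℝ) : ℂ) := by
  have hd := dim_ne_zero (d := d)
  have h1 : (1 : Op d).trace = (d : ℂ) ^ 2 := by simp [Matrix.trace_one, sq]
  simp only [maxMixed, sub_mul, mul_sub, Matrix.smul_mul, Matrix.mul_smul, one_mul, mul_one,
    Matrix.trace_sub, Matrix.trace_smul, hσ, h1, smul_eq_mul]
  push_cast
  field_simp
  ring

/-- Among states, the distance to the maximally mixed state is a function of the purity. -/
theorem hsDist_maxMixed {σ : Op d} (hσ : σ.trace = 1) :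
    hsDist d σ (maxMixed d) = √((σ * σ).trace.re - 1 / (d : ℝ) ^ 2) := by
  rw [hsDist, trace_sub_maxMixed_mul_self hσ, Complex.sub_re, Complex.ofReal_re]

theorem inv_dim_sq_le_purity {σ : Op d} (hσ : σ ∈ LMM d) :
    1 / (d : ℝ) ^ 2 ≤ (σ * σ).trace.re := by
  have hH : (σ - maxMixed d)ᴴ = σ - maxMixed d := by
    rw [Matrix.conjTranspose_sub, hσ.1.isHermitian.eq, maxMixed, Matrix.conjTranspose_smul]
    simp
  have h := (Matrix.posSemidef_conjTranspose_mul_self (σ - maxMixed d)).trace_nonneg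
  rw [hH, trace_sub_maxMixed_mul_self hσ.2.1] at h
  have h2 := (Complex.le_def.mp h).1
  rw [Complex.sub_re, Complex.ofReal_re, Complex.zero_re] at h2
  linarith

theorem convex_posSemidef {n : Type*} [Fintype n] {V : Type*} [AddCommGroup V] [Module ℝ V]
    {f : V → Matrix n n ℂ} (hf : IsLinearMap ℝ f) : Convex ℝ {σ | (f σ).PosSemidef} := by
  intro σ hσ τ hτ a b ha hb _
  have h : f (a • σ + b • τ) = (a : ℂ) • f σ + (b : ℂ) • f τ := by
    rw [hf.map_add, hf.map_smul, hf.map_smul]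
    rfl
  rw [Set.mem_ofPred_eq, h]
  exact (Matrix.PosSemidef.smul hσ (by exact_mod_cast ha)).add
    (Matrix.PosSemidef.smul hτ (by exact_mod_cast hb))

theorem posSemidef_one_sub_vecMulVec {n : Type*} [Fintype n] [DecidableEq n] {v : n → ℂ}
    (hv : star v ⬝ᵥ v = 1) : (1 - Matrix.vecMulVec v (star v)).PosSemidef := by
  -- the matrix is an orthogonal projection
  have hP : (Matrix.vecMulVec v (star v))ᴴ = Matrix.vecMulVec v (star v) :=
    (Matrix.posSemidef_vecMulVec_self_star v).isHermitian
  have h : 1 - Matrix.vecMulVec v (star v) =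
      (1 - Matrix.vecMulVec v (star v))ᴴ * (1 - Matrix.vecMulVec v (star v)) := by
    rw [Matrix.conjTranspose_sub, hP, Matrix.conjTranspose_one, sub_mul, one_mul, mul_sub,
      mul_one, Matrix.vecMulVec_mul_vecMulVec, hv, one_smul, sub_self, sub_zero]
  rw [h]
  exact Matrix.posSemidef_conjTranspose_mul_self _

/-- The reduction criterion: a separable state `σ` with first marginal `σ_A` satisfies
`σ ≤ σ_A ⊗ 1`. -/
theorem posSemidef_reduction {σ : Op d} (hσ : σ ∈ SEP d) :
    (partialTraceB d σ ⊗ₖ (1 : LocalOp d) - σ).PosSemidef := by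
  have hlin : IsLinearMap ℝ fun σ : Op d => partialTraceB d σ ⊗ₖ (1 : LocalOp d) - σ := by
    constructor
    · intro σ τ
      ext x y
      simp only [partialTraceB, Matrix.sub_apply, Matrix.kroneckerMap_apply, Matrix.of_apply,
        Matrix.add_apply, Finset.sum_add_distrib]
      ring
    · intro c σ
      ext x y
      simp only [partialTraceB, Matrix.sub_apply, Matrix.kroneckerMap_apply, Matrix.of_apply,
        Matrix.smul_apply, Complex.real_smul, ← Finset.mul_sum]
      ring
  refine convexHull_min ?_ (convex_posSemidef hlin) hσ
  rintro σ ⟨φ, ψ, -, hψ, rfl⟩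
  rw [sum_norm_sq_eq_one_iff] at hψ
  have h : partialTraceB d (Matrix.vecMulVec (prodVec d φ ψ) (star (prodVec d φ ψ))) ⊗ₖ
        (1 : LocalOp d) - Matrix.vecMulVec (prodVec d φ ψ) (star (prodVec d φ ψ)) =
      Matrix.vecMulVec φ (star φ) ⊗ₖ (1 - Matrix.vecMulVec ψ (star ψ)) := by
    ext ⟨r, t⟩ ⟨s, u⟩
    have hψ' : ∑ a, ψ a * star (ψ a) = 1 := by
      rw [← hψ, dotProduct_comm]
      rfl
    simp only [partialTraceB, prodVec, Matrix.sub_apply, Matrix.kroneckerMap_apply,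
      Matrix.of_apply, Matrix.vecMulVec_apply, Pi.star_apply, star_mul']
    have h2 : ∑ a, φ r * ψ a * (star (φ s) * star (ψ a)) = φ r * star (φ s) := by
      rw [← mul_one (φ r * star (φ s)), ← hψ', Finset.mul_sum]
      exact Finset.sum_congr rfl fun a _ => by ring
    rw [h2]
    ring
  rw [Set.mem_ofPred_eq, h]
  exact (Matrix.posSemidef_vecMulVec_self_star φ).kronecker (posSemidef_one_sub_vecMulVec hψ)

/-- A separable state with maximally mixed marginals is at most `1 / d`. -/
theorem posSemidef_inv_smul_one_sub {σ : Op d} (hσ : σ ∈ SEP d) (hσ' : σ ∈ LMM d) :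
    ((1 / (d : ℂ)) • (1 : Op d) - σ).PosSemidef := by
  have h := posSemidef_reduction hσ
  rwa [hσ'.2.2.1, Matrix.smul_kronecker, Matrix.one_kronecker_one] at h

theorem trace_mul_nonneg {n : Type*} [Fintype n] {A B : Matrix n n ℂ} (hA : A.PosSemidef)
    (hB : B.PosSemidef) : 0 ≤ (A * B).trace := by
  classical
  open scoped MatrixOrder Matrix.Norms.L2Operator in
  obtain ⟨C, rfl⟩ := CStarAlgebra.nonneg_iff_eq_star_mul_self.mp hB.nonneg
  rw [Matrix.star_eq_conjTranspose, ← Matrix.mul_assoc, Matrix.trace_mul_comm, ← Matrix.mul_assoc]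
  exact (hA.mul_mul_conjTranspose_same C).trace_nonneg

/-- `Tr σ² ≤ Tr σ / d`, as the trace of the product of `1 / d - σ ≥ 0` and `σ ≥ 0` is non-negative. -/
theorem purity_le {σ : Op d} (hσ : σ ∈ SEP d) (hσ' : σ ∈ LMM d) :
    (σ * σ).trace.re ≤ 1 / d := by
  have h := trace_mul_nonneg (posSemidef_inv_smul_one_sub hσ hσ') hσ'.1
  rw [sub_mul, Matrix.trace_sub, Matrix.smul_mul, one_mul, Matrix.trace_smul, hσ'.2.1,
    smul_eq_mul, mul_one] at h
  have h2 := (Complex.le_def.mp h).1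
  rw [Complex.sub_re, Complex.zero_re] at h2
  have h3 : (1 / (d : ℂ)).re = 1 / d := by
    rw [← Complex.ofReal_natCast, ← Complex.ofReal_one, ← Complex.ofReal_div, Complex.ofReal_re]
  linarith

theorem coeff_le {c : Phase d → ℝ} (h : ∑ x, (c x : ℂ) • bell d x ∈ SEP d)
    (h' : ∑ x, (c x : ℂ) • bell d x ∈ LMM d) (x : Phase d) : c x ≤ 1 / d := by
  have h0 := (posSemidef_inv_smul_one_sub h h').dotProduct_mulVec_nonneg (bellVec d x)
  rw [Matrix.sub_mulVec, dotProduct_sub, star_bellVec_dotProduct_sum_mulVec, Matrix.smul_mulVec,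
    Matrix.one_mulVec, dotProduct_smul, star_bellVec_dotProduct_bellVec, if_pos rfl, smul_eq_mul,
    mul_one, sub_nonneg] at h0
  have : ((c x : ℝ) : ℂ) ≤ ((1 / d : ℝ) : ℂ) := by push_cast; exact h0
  exact Complex.real_le_real.mp this

/-! ### Equidistributions -/

theorem rho_eq_sum (Q : Finset (Phase d)) :
    rho d Q = ∑ x, (((if x ∈ Q then 1 / (Q.card : ℝ) else 0 : ℝ)) : ℂ) • bell d x := by
  rw [rho, Finset.smul_sum, ← Finset.sum_filter_add_sum_filter_not Finset.univ (· ∈ Q)]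
  rw [Finset.sum_eq_zero (s := Finset.univ.filter (· ∉ Q)), add_zero,
    Finset.filter_mem_eq_inter, Finset.univ_inter]
  · refine Finset.sum_congr rfl fun x hx => ?_
    simp [hx]
  · intro x hx
    simp [(Finset.mem_filter.mp hx).2]

theorem rho_mem_magicSimplex {Q : Finset (Phase d)} (hQ : Q.Nonempty) :
    rho d Q ∈ magicSimplex d := by
  refine ⟨_, fun x => ?_, ?_, rho_eq_sum Q⟩
  · split_ifs <;> positivity
  · have : (Q.card : ℝ) ≠ 0 := by exact_mod_cast hQ.card_pos.ne'
    simp [Finset.sum_ite_mem, this]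

theorem trace_rho_mul_self {Q : Finset (Phase d)} (hQ : Q.card = d) :
    (rho d Q * rho d Q).trace = ((1 / d : ℝ) : ℂ) := by
  have := dim_pos (d := d)
  rw [rho_eq_sum, trace_sum_smul_bell_mul_self, hQ]
  congr 1
  simp only [ite_pow, Finset.sum_ite_mem, Finset.univ_inter, ne_eq, OfNat.ofNat_ne_zero,
    not_false_eq_true, zero_pow, Finset.sum_const, hQ, nsmul_eq_mul]
  field_simp

theorem nonempty_of_card_eq_dim {Q : Finset (Phase d)} (hQ : Q.card = d) : Q.Nonempty :=
  Finset.card_pos.mp (hQ.symm ▸ NeZero.pos d)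

theorem trace_rho {Q : Finset (Phase d)} (hQ : Q.card = d) : (rho d Q).trace = 1 :=
  (magicSimplex_subset_LMM (rho_mem_magicSimplex (nonempty_of_card_eq_dim hQ))).2.1

theorem rho_injOn : Set.InjOn (rho d) {Q | Q.card = d} := by
  intro Q hQ R hR h
  have hd := dim_pos (d := d)
  ext x
  have h1 := congrArg (fun σ => star (bellVec d x) ⬝ᵥ (σ *ᵥ bellVec d x)) h
  simp only [rho_eq_sum, star_bellVec_dotProduct_sum_mulVec] at h1
  rw [Set.mem_ofPred_eq] at hQ hR
  rw [hQ, hR] at h1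
  have h2 := Complex.ofReal_injective h1
  have h3 : (1 / d : ℝ) ≠ 0 := by positivity
  clear h h1 hd hQ hR
  by_cases hxQ : x ∈ Q <;> by_cases hxR : x ∈ R <;> simp only [hxQ, hxR, if_true, if_false] at h2 ⊢
  · exact (h3 h2).elim
  · exact (h3 h2.symm).elim

/-- An element of the magic simplex that is separable and has the largest possible purity is an
equidistribution over `d` points. -/
theorem exists_eq_rho_of_purity {σ : Op d} (hσ : σ ∈ SEP d) (hσ' : σ ∈ magicSimplex d)
    (h : 1 / (d : ℝ) ≤ (σ * σ).trace.re) : ∃ Q : Finset (Phase d), Q.card = d ∧ σ = rho d Q := by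
  have hd := dim_pos (d := d)
  have hL := magicSimplex_subset_LMM hσ'
  obtain ⟨c, hc, hsum, rfl⟩ := hσ'
  rw [trace_sum_smul_bell_mul_self, Complex.ofReal_re] at h
  have hle := coeff_le hσ hL
  -- `∑ c x (1 / d - c x) ≤ 0` although every term is non-negative
  have hnn : ∀ x ∈ Finset.univ, 0 ≤ c x * (1 / d - c x) := fun x _ =>
    mul_nonneg (hc x) (sub_nonneg.mpr (hle x))
  have hz : ∑ x, c x * (1 / d - c x) = 0 := by
    refine le_antisymm ?_ (Finset.sum_nonneg hnn)
    simp_rw [mul_sub, ← sq]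
    rw [Finset.sum_sub_distrib, ← Finset.sum_mul, hsum]
    linarith
  have hval (x : Phase d) : c x = if c x ≠ 0 then 1 / (d : ℝ) else 0 := by
    rcases mul_eq_zero.mp ((Finset.sum_eq_zero_iff_of_nonneg hnn).mp hz x (Finset.mem_univ x))
      with h0 | h0
    · simp [h0]
    · have hx : c x = 1 / d := by linarith
      have : c x ≠ 0 := by rw [hx]; positivity
      rw [if_pos this, hx]
  have hcard : (Finset.univ.filter fun x => c x ≠ 0).card = d := by
    rw [Finset.sum_congr rfl fun x _ => hval x, ← Finset.sum_filter, Finset.sum_const,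
      nsmul_eq_mul, mul_one_div, div_eq_one_iff_eq hd.ne'] at hsum
    exact_mod_cast hsum
  refine ⟨_, hcard, ?_⟩
  rw [rho_eq_sum, hcard]
  refine Finset.sum_congr rfl fun x _ => ?_
  nth_rw 1 [hval x]
  simp

/-! ### Subgroups of the phase space with `d` elements are isotropic -/

theorem mul_eq_zero_of_card_mul_card {A B : AddSubgroup (ZMod d)}
    (h : Nat.card A * Nat.card B = d) {a b : ZMod d} (ha : a ∈ A) (hb : b ∈ B) : a * b = 0 := by
  have hB : Nat.card B • b = 0 := 
    congrArg Subtype.val (card_nsmul_eq_zero' (x := (⟨b, hb⟩ : B)))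
  have hA : Nat.card A • a = 0 := 
    congrArg Subtype.val (card_nsmul_eq_zero' (x := (⟨a, ha⟩ : A)))
  -- `b` is killed by `|B|`, hence a multiple of `|A| = d / |B|`
  have hdvd : Nat.card A ∣ b.val := by
    have h1 : ((Nat.card B * b.val : ℕ) : ZMod d) = 0 := by
      rw [Nat.cast_mul, ZMod.natCast_val, ZMod.cast_id', id, ← nsmul_eq_mul, hB]
    rw [ZMod.natCast_eq_zero_iff] at h1
    nth_rw 1 [← h] at h1
    rw [mul_comm] at h1
    exact Nat.dvd_of_mul_dvd_mul_left Nat.card_pos h1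
  obtain ⟨t, ht⟩ := hdvd
  have hb' : b = (Nat.card A : ZMod d) * t := by
    rw [← Nat.cast_mul, ← ht, ZMod.natCast_val, ZMod.cast_id', id]
  rw [hb', ← mul_assoc, mul_comm a, ← nsmul_eq_mul, hA, zero_mul]

/-- The symplectic form vanishes on a subgroup `H` with `d` elements. With `A` the image of `H` under
the first projection and `B` the kernel, `|A| |B| = d` forces `A B = 0`, and `A` is cyclic. -/
theorem symplectic_eq_zero {H : AddSubgroup (Phase d)} (hH : Nat.card H = d) {x y : Phase d}
    (hx : x ∈ H) (hy : y ∈ H) : x.1 * y.2 = y.1 * x.2 := by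
  let A : AddSubgroup (ZMod d) := H.map (AddMonoidHom.fst _ _)
  let B : AddSubgroup (ZMod d) := H.comap (AddMonoidHom.inr _ _)
  have hcard : Nat.card A * Nat.card B = d := by
    let f : H →+ ZMod d := (AddMonoidHom.fst (ZMod d) (ZMod d)).comp H.subtype
    have hA : f.range = A := by
      ext a
      simp [f, A]
    let e : B ≃ f.ker :=
      { toFun := fun b => ⟨⟨(0, b.1), b.2⟩, rfl⟩
        invFun := fun k => ⟨k.1.1.2, by
          have h1 : k.1.1.1 = 0 := k.2
          change ((0 : ZMod d), k.1.1.2) ∈ H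
          rw [← h1]
          exact k.1.2⟩
        left_inv := fun b => rfl
        right_inv := fun k => by
          have h1 : k.1.1.1 = 0 := k.2
          exact Subtype.ext (Subtype.ext (Prod.ext h1.symm rfl)) }
    rw [← hA, Nat.card_congr e, mul_comm, ← AddSubgroup.index_ker, AddSubgroup.card_mul_index, hH]
  obtain ⟨⟨a, ha⟩, hgen⟩ := IsAddCyclic.exists_zsmul_surjective (G := A)
  obtain ⟨z, hz, rfl⟩ := ha
  have key (x : Phase d) (hx : x ∈ H) : ∃ n : ℤ, ∃ b ∈ B, x = n • z + (0, b) := by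
    obtain ⟨n, hn⟩ := hgen ⟨x.1, x, hx, rfl⟩
    have hn' : n • z.1 = x.1 := congrArg Subtype.val hn
    have hsub : ((0 : ZMod d), (x - n • z).2) = x - n • z :=
      Prod.ext (sub_eq_zero.mpr hn'.symm).symm rfl
    refine ⟨n, (x - n • z).2, ?_, ?_⟩
    · change ((0 : ZMod d), (x - n • z).2) ∈ H
      rw [hsub]
      exact H.sub_mem hx (H.zsmul_mem hz n)
    · rw [hsub]
      abel
  obtain ⟨n, b, hb, rfl⟩ := key x hx
  obtain ⟨m, c, hc, rfl⟩ := key y hy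
  have hzA : z.1 ∈ A := ⟨z, hz, rfl⟩
  have h1 := mul_eq_zero_of_card_mul_card hcard hzA hb
  have h2 := mul_eq_zero_of_card_mul_card hcard hzA hc
  simp only [Prod.fst_add, Prod.snd_add, Prod.smul_fst, Prod.smul_snd, add_zero]
  simp only [zsmul_eq_mul]
  linear_combination (n : ZMod d) * h2 - (m : ZMod d) * h1

/-! ### Common eigenvectors -/

theorem exists_common_eigenvector {ι V : Type*} [AddCommGroup V] [Module ℂ V]
    [FiniteDimensional ℂ V] [Nontrivial V] (f : ι → Module.End ℂ V)
    (hf : ∀ i j, Commute (f i) (f j)) : ∃ v ≠ 0, ∀ i, ∃ μ : ℂ, f i v = μ • v := by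
  induction hn : Module.finrank ℂ V using Nat.strong_induction_on generalizing V with
  | _ n ih =>
    by_cases hall : ∀ i, ∃ μ : ℂ, (f i).eigenspace μ = ⊤
    · obtain ⟨v, hv⟩ := exists_ne (0 : V)
      refine ⟨v, hv, fun i => ?_⟩
      obtain ⟨μ, hμ⟩ := hall i
      exact ⟨μ, Module.End.mem_eigenspace_iff.mp (hμ ▸ Submodule.mem_top)⟩
    · push Not at hall
      -- all the maps restrict to a proper eigenspace of one of them
      obtain ⟨i, hi⟩ := hall
      obtain ⟨μ, hμ⟩ := (f i).exists_eigenvalue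
      have hmaps (j : ι) : ∀ v ∈ (f i).eigenspace μ, f j v ∈ (f i).eigenspace μ := fun v hv => by
        rw [Module.End.mem_eigenspace_iff] at hv ⊢
        rw [← Module.End.mul_apply, (hf i j).eq, Module.End.mul_apply, hv, map_smul]
      have : Nontrivial ((f i).eigenspace μ) := Submodule.nontrivial_iff_ne_bot.mpr hμ
      obtain ⟨v, hv, hv'⟩ := ih _ (hn ▸ Submodule.finrank_lt (hi μ))
        (fun j => (f j).restrict (hmaps j)) (fun j k => by
          ext v
          exact congrArg (fun g => g v.1) (hf j k).eq) rfl
      refine ⟨v, by simpa using hv, fun j => ?_⟩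
      obtain ⟨ν, hν⟩ := hv' j
      exact ⟨ν, congrArg Subtype.val hν⟩

theorem exists_smul_star_dotProduct_self {n : Type*} [Fintype n] {v : n → ℂ} (hv : v ≠ 0) :
    ∃ c : ℂ, star (c • v) ⬝ᵥ (c • v) = 1 := by
  have hpos : 0 < ∑ s, ‖v s‖ ^ 2 := by
    obtain ⟨s, hs⟩ := Function.ne_iff.mp hv
    refine Finset.sum_pos' (fun _ _ => by positivity) ⟨s, Finset.mem_univ s, ?_⟩
    have : v s ≠ 0 := hs
    positivity
  refine ⟨((1 / √(∑ s, ‖v s‖ ^ 2) : ℝ) : ℂ), ?_⟩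
  rw [star_smul, smul_dotProduct, dotProduct_smul, star_dotProduct_self, Complex.star_def,
    Complex.conj_ofReal, smul_eq_mul, smul_eq_mul, ← mul_assoc, ← Complex.ofReal_mul,
    div_mul_div_comm, Real.mul_self_sqrt hpos.le, ← Complex.ofReal_mul, one_mul,
    one_div_mul_cancel hpos.ne', Complex.ofReal_one]

/-- The Weyl operators of an isotropic set have a common eigenvector. -/
theorem exists_weylLocal_eigenvector {H : Set (Phase d)}
    (hH : ∀ x ∈ H, ∀ y ∈ H, x.1 * y.2 = y.1 * x.2) :
    ∃ v : ZMod d → ℂ, star v ⬝ᵥ v = 1 ∧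
      ∀ x ∈ H, ∃ μ : ℂ, weylLocal d x.1 x.2 *ᵥ v = μ • v := by
  obtain ⟨v, hv, hμ⟩ := exists_common_eigenvector
    (fun x : H => Matrix.toLin' (weylLocal d x.1.1 x.1.2)) (fun x y => by
      rw [Commute, SemiconjBy, Module.End.mul_eq_comp, Module.End.mul_eq_comp,
        ← Matrix.toLin'_mul, ← Matrix.toLin'_mul,
        weylLocal_mul, weylLocal_mul, hH x x.2 y y.2, add_comm y.1.1, add_comm y.1.2])
  obtain ⟨c, hc⟩ := exists_smul_star_dotProduct_self hv
  refine ⟨c • v, hc, fun x hx => ?_⟩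
  obtain ⟨μ, h⟩ := hμ ⟨x, hx⟩
  rw [Matrix.toLin'_apply] at h
  exact ⟨μ, by rw [Matrix.mulVec_smul, h, smul_comm]⟩

/-! ### Twirling -/

theorem weylLocal_mul_comm (x y : Phase d) :
    weylLocal d x.1 x.2 * weylLocal d y.1 y.2 =
      phase d (y.1 * x.2 - x.1 * y.2) • (weylLocal d y.1 y.2 * weylLocal d x.1 x.2) := by
  rw [weylLocal_mul, weylLocal_mul, smul_smul, ← phase_add, sub_add_cancel, add_comm y.1,
    add_comm y.2]

/-- The Bell states are eigenvectors of `W_y ⊗ W̄_y`, with the symplectic form in the phase. -/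
theorem amplitude_weylLocal (x y : Phase d) (φ ψ : ZMod d → ℂ) :
    amplitude x (weylLocal d y.1 y.2 *ᵥ φ) (star (weylLocal d y.1 y.2 *ᵥ star ψ)) =
      phase d (x.1 * y.2 - y.1 * x.2) * amplitude x φ ψ := by
  rw [amplitude_eq, amplitude_eq, star_star, Matrix.mulVec_mulVec, weylLocal_mul_comm,
    Matrix.smul_mulVec, ← Matrix.mulVec_mulVec, star_smul, smul_dotProduct,
    star_mulVec_dotProduct_mulVec (conjTranspose_weylLocal_mul_self _ _), star_phase, neg_sub,
    smul_eq_mul]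
  ring

theorem sum_phase_symplectic (x x' : Phase d) :
    ∑ y : Phase d, phase d (x.1 * y.2 - y.1 * x.2) * star (phase d (x'.1 * y.2 - y.1 * x'.2)) =
      if x = x' then (d : ℂ) ^ 2 else 0 := by
  have h (y : Phase d) :
      phase d (x.1 * y.2 - y.1 * x.2) * star (phase d (x'.1 * y.2 - y.1 * x'.2)) =
        phase d (y.1 * (x'.2 - x.2)) * phase d (y.2 * (x.1 - x'.1)) := by
    rw [star_phase, ← phase_add, ← phase_add]
    congr 1
    ring
  simp_rw [h]
  rw [Fintype.sum_prod_type]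
  simp_rw [← Finset.mul_sum]
  rw [← Finset.sum_mul, sum_phase_mul, sum_phase_mul]
  by_cases h1 : x.1 = x'.1 <;> by_cases h2 : x.2 = x'.2 <;>
    simp [Prod.ext_iff, h1, h2, sub_eq_zero, sq, eq_comm]

/-- Averaging a product vector over the unitaries `W_y ⊗ W̄_y` yields its Bell-diagonal part. -/
theorem twirl (φ ψ : ZMod d → ℂ) :
    ∑ y : Phase d, (1 / (d : ℝ) ^ 2) •
      Matrix.vecMulVec
        (prodVec d (weylLocal d y.1 y.2 *ᵥ φ) (star (weylLocal d y.1 y.2 *ᵥ star ψ)))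
        (star (prodVec d (weylLocal d y.1 y.2 *ᵥ φ) (star (weylLocal d y.1 y.2 *ᵥ star ψ)))) =
      ∑ x, ((‖amplitude x φ ψ‖ ^ 2 : ℝ) : ℂ) • bell d x := by
  have hd := dim_ne_zero (d := d)
  ext i j
  simp_rw [prodVec_eq_sum (weylLocal d _ _ *ᵥ φ), amplitude_weylLocal]
  simp only [Matrix.sum_apply, Matrix.smul_apply, Matrix.vecMulVec_apply, Finset.sum_apply,
    Pi.smul_apply, Pi.star_apply, smul_eq_mul, star_sum, star_mul', Finset.sum_mul_sum, bell]
  simp_rw [Complex.real_smul, Finset.mul_sum]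
  rw [Finset.sum_comm]
  refine Finset.sum_congr rfl fun x _ => ?_
  rw [Finset.sum_comm]
  have h (x' : Phase d) : ∑ y : Phase d, ((1 / (d : ℝ) ^ 2 : ℝ) : ℂ) *
      (phase d (x.1 * y.2 - y.1 * x.2) * amplitude x φ ψ * bellVec d x i *
        (star (phase d (x'.1 * y.2 - y.1 * x'.2)) * star (amplitude x' φ ψ) *
          star (bellVec d x' j))) =
      if x = x' then amplitude x φ ψ * star (amplitude x' φ ψ) *
        (bellVec d x i * star (bellVec d x' j)) else 0 := by
    rw [Finset.sum_congr rfl (g := fun y : Phase d =>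
      phase d (x.1 * y.2 - y.1 * x.2) * star (phase d (x'.1 * y.2 - y.1 * x'.2)) *
        (1 / (d : ℂ) ^ 2 * (amplitude x φ ψ * star (amplitude x' φ ψ) *
          (bellVec d x i * star (bellVec d x' j))))) fun y _ => by push_cast; ring]
    rw [← Finset.sum_mul, sum_phase_symplectic]
    split_ifs
    · rw [← mul_assoc, mul_one_div_cancel (pow_ne_zero 2 hd), one_mul]
    · rw [zero_mul]
  simp_rw [h]
  rw [Finset.sum_ite_eq, if_pos (Finset.mem_univ x), Complex.star_def, Complex.mul_conj']
  push_cast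
  rfl

theorem sum_norm_sq_amplitude_smul_bell_mem_SEP {φ ψ : ZMod d → ℂ} (hφ : star φ ⬝ᵥ φ = 1)
    (hψ : star ψ ⬝ᵥ ψ = 1) : ∑ x, ((‖amplitude x φ ψ‖ ^ 2 : ℝ) : ℂ) • bell d x ∈ SEP d := by
  have hd := dim_pos (d := d)
  rw [← twirl]
  refine (convex_convexHull ℝ _).sum_mem (fun _ _ => by positivity) ?_ fun y _ => ?_
  · simp [ZMod.card]
    field_simp
  · refine subset_convexHull ℝ _ ⟨_, _, ?_, ?_, rfl⟩
    · rw [sum_norm_sq_eq_one_iff]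
      exact star_weylLocal_mulVec_dotProduct_self y hφ
    · rw [sum_norm_sq_eq_one_iff]
      exact star_star_dotProduct_star
        (star_weylLocal_mulVec_dotProduct_self y (star_star_dotProduct_star hψ))

/-- An equidistribution over `d` points is separable as soon as some product vector has maximal
overlap with all the Bell states of these points: it is the twirl of this product vector. -/
theorem rho_mem_SEP_of_amplitude {Q : Finset (Phase d)} (hQ : Q.card = d) {φ ψ : ZMod d → ℂ}
    (hφ : star φ ⬝ᵥ φ = 1) (hψ : star ψ ⬝ᵥ ψ = 1)
    (h : ∀ x ∈ Q, ‖amplitude x φ ψ‖ ^ 2 = 1 / d) : rho d Q ∈ SEP d := by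
  have hsum := sum_norm_sq_amplitude hφ hψ
  have hQsum : ∑ x ∈ Q, ‖amplitude x φ ψ‖ ^ 2 = 1 := by
    rw [Finset.sum_congr rfl h, Finset.sum_const, hQ, nsmul_eq_mul,
      mul_one_div_cancel dim_pos.ne']
  have hzero : ∀ x ∉ Q, ‖amplitude x φ ψ‖ ^ 2 = 0 := by
    intro x hx
    rw [← Finset.sum_add_sum_compl Q, hQsum, add_eq_left,
      Finset.sum_eq_zero_iff_of_nonneg fun _ _ => by positivity] at hsum
    exact hsum x (Finset.mem_compl.mpr hx)
  convert sum_norm_sq_amplitude_smul_bell_mem_SEP hφ hψ using 1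
  rw [rho_eq_sum]
  refine Finset.sum_congr rfl fun x _ => ?_
  by_cases hx : x ∈ Q
  · rw [h x hx, if_pos hx, hQ]
  · rw [hzero x hx, if_neg hx]

theorem rho_mem_SEP_of_translate {Q : Finset (Phase d)} (hQ : Q.card = d) {x₀ : Phase d}
    {H : AddSubgroup (Phase d)} (hH : Nat.card H = d)
    (h : ∀ x ∈ Q, ∃ y ∈ H, x = x₀ + y) : rho d Q ∈ SEP d := by
  obtain ⟨v, hv, hμ⟩ := exists_weylLocal_eigenvector (H := (H : Set (Phase d)))
    fun x hx y hy => symplectic_eq_zero hH hx hy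
  refine rho_mem_SEP_of_amplitude hQ (φ := weylLocal d x₀.1 x₀.2 *ᵥ v) (ψ := star v)
    (star_weylLocal_mulVec_dotProduct_self x₀ hv) (star_star_dotProduct_star hv) fun x hx => ?_
  rw [norm_sq_amplitude_eq_iff _ (star_weylLocal_mulVec_dotProduct_self x₀ hv)
    (star_star_dotProduct_star hv), star_star]
  obtain ⟨y, hy, rfl⟩ := h x hx
  obtain ⟨μ, hy⟩ := hμ y hy
  have hmul := congrArg (· *ᵥ v) (weylLocal_mul d x₀.1 x₀.2 y.1 y.2)
  simp only [← Matrix.mulVec_mulVec, hy, Matrix.mulVec_smul, Matrix.smul_mulVec] at hmul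
  have hμ0 : μ ≠ 0 := by
    rintro rfl
    have h1 := star_weylLocal_mulVec_dotProduct_self y hv
    rw [hy] at h1
    simp at h1
  refine ⟨μ⁻¹ * phase d (y.1 * x₀.2), ?_⟩
  rw [mul_smul, Prod.fst_add, Prod.snd_add, ← hmul, smul_smul, inv_mul_cancel₀ hμ0, one_smul]

/-! ### Points of maximal overlap with one product vector -/

/-- The phase space points whose Weyl operator has `v` as an eigenvector. Weyl operators are
invertible, so asking for a nonzero eigenvalue is no restriction. -/
def eigenSubgroup (v : ZMod d → ℂ) : AddSubgroup (Phase d) where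
  carrier := {x | ∃ c : ℂ, c ≠ 0 ∧ weylLocal d x.1 x.2 *ᵥ v = c • v}
  zero_mem' := ⟨1, one_ne_zero, by simp [weylLocal_zero]⟩
  add_mem' := by
    rintro x y ⟨a, ha, hxa⟩ ⟨b, hb, hyb⟩
    have h := congrArg (· *ᵥ v) (weylLocal_mul d x.1 x.2 y.1 y.2)
    simp only [← Matrix.mulVec_mulVec, hyb, Matrix.mulVec_smul, hxa, Matrix.smul_mulVec] at h
    refine ⟨phase d (-(y.1 * x.2)) * (b * a), ?_, ?_⟩
    · exact mul_ne_zero (left_ne_zero_of_mul_eq_one (by rw [mul_comm, phase_mul_phase_neg]))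
        (mul_ne_zero hb ha)
    · rw [mul_smul, mul_smul, h, smul_smul, mul_comm, phase_mul_phase_neg, one_smul]
      rfl
  neg_mem' := by
    rintro x ⟨a, ha, hxa⟩
    have h := congrArg (· *ᵥ v) (weylLocal_mul d (-x.1) (-x.2) x.1 x.2)
    simp only [← Matrix.mulVec_mulVec, Matrix.mulVec_smul, hxa, Matrix.smul_mulVec,
      neg_add_cancel, weylLocal_zero, Matrix.one_mulVec] at h
    refine ⟨a⁻¹ * phase d (x.1 * -x.2), ?_, ?_⟩
    · exact mul_ne_zero (inv_ne_zero ha) (left_ne_zero_of_mul_eq_one (phase_mul_phase_neg _))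
    · rw [mul_smul, ← h, smul_smul, inv_mul_cancel₀ ha, one_smul]
      rfl

/-- A product vector has maximal overlap `1 / d` with at most `d` Bell states, as the overlaps with
all Bell states add up to `1`. -/
theorem card_eigenSubgroup_le {v : ZMod d → ℂ} (hv : star v ⬝ᵥ v = 1) :
    Nat.card (eigenSubgroup v) ≤ d := by
  classical
  have hd := dim_pos (d := d)
  have hψ := star_star_dotProduct_star hv
  let S : Finset (Phase d) := Finset.univ.filter (· ∈ eigenSubgroup v)
  have hS : Nat.card (eigenSubgroup v) = S.card := by
    rw [Nat.card_eq_fintype_card, Fintype.card_subtype]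
  have hle : ∑ x ∈ S, ‖amplitude x v (star v)‖ ^ 2 ≤ 1 := by
    rw [← sum_norm_sq_amplitude hv hψ]
    exact Finset.sum_le_univ_sum_of_nonneg fun _ => by positivity
  have hval : ∀ x ∈ S, ‖amplitude x v (star v)‖ ^ 2 = 1 / d := by
    intro x hx
    obtain ⟨c, hc, hxc⟩ := (Finset.mem_filter.mp hx).2
    rw [norm_sq_amplitude_eq_iff _ hv hψ, star_star, hxc]
    exact ⟨c⁻¹, by rw [smul_smul, inv_mul_cancel₀ hc, one_smul]⟩
  rw [Finset.sum_congr rfl hval, Finset.sum_const, nsmul_eq_mul, mul_one_div,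
    div_le_one hd] at hle
  rw [hS]
  exact_mod_cast hle

theorem translate_eq_image {G : Type*} [AddGroup G] (x : G) (H : AddSubgroup G) :
    {y | ∃ z ∈ H, y = x + z} = (x + ·) '' (H : Set G) :=
  Set.ext fun _ => exists_congr fun _ => and_congr_right fun _ => eq_comm

/-- If one product vector has maximal overlap with `d` Bell states, then their phase space points form
a translate of the subgroup of those `x` for which `ψ̄` is an eigenvector of `W_x`. -/
theorem isSublattice_of_amplitude {Q : Finset (Phase d)} (hQ : Q.card = d) {φ ψ : ZMod d → ℂ}
    (hφ : star φ ⬝ᵥ φ = 1) (hψ : star ψ ⬝ᵥ ψ = 1)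
    (h : ∀ x ∈ Q, ‖amplitude x φ ψ‖ ^ 2 = 1 / d) : IsSublattice d Q := by
  obtain ⟨x₀, hx₀⟩ := nonempty_of_card_eq_dim hQ
  have hη := star_star_dotProduct_star hψ
  have hprop (x : Phase d) (hx : x ∈ Q) :
      ∃ c : ℂ, c ≠ 0 ∧ φ = c • (weylLocal d x.1 x.2 *ᵥ star ψ) := by
    obtain ⟨c, hc⟩ := (norm_sq_amplitude_eq_iff x hφ hψ).mp (h x hx)
    refine ⟨c, ?_, hc⟩
    rintro rfl
    rw [hc] at hφ
    simp at hφ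
  refine ⟨x₀, eigenSubgroup (star ψ), ?_⟩
  rw [translate_eq_image]
  refine Set.eq_of_subset_of_ncard_le ?_ ?_ (Set.toFinite _)
  · intro x hx
    refine ⟨x - x₀, ?_, add_sub_cancel x₀ x⟩
    obtain ⟨a, ha, hφa⟩ := hprop x hx
    obtain ⟨b, hb, hφb⟩ := hprop x₀ hx₀
    have hmul := congrArg (fun M => (weylLocal d x₀.1 x₀.2)ᴴ *ᵥ (M *ᵥ star ψ))
      (weylLocal_mul d x₀.1 x₀.2 (x - x₀).1 (x - x₀).2)
    have hx' : weylLocal d x.1 x.2 *ᵥ star ψ = (a⁻¹ * b) • (weylLocal d x₀.1 x₀.2 *ᵥ star ψ) := by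
      rw [mul_smul, ← hφb, hφa, smul_smul, inv_mul_cancel₀ ha, one_smul]
    simp only [Prod.fst_sub, Prod.snd_sub, add_sub_cancel, Matrix.smul_mulVec, hx',
      ← Matrix.mulVec_mulVec, Matrix.mulVec_smul] at hmul
    simp only [Matrix.mulVec_mulVec, ← Matrix.mul_assoc, conjTranspose_weylLocal_mul_self,
      Matrix.one_mulVec, Matrix.one_mul, smul_smul] at hmul
    exact ⟨_, mul_ne_zero (left_ne_zero_of_mul_eq_one (phase_mul_phase_neg _))
      (mul_ne_zero (inv_ne_zero ha) hb), hmul⟩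
  · rw [Set.ncard_image_of_injective _ (add_right_injective x₀), Set.ncard_coe_finset, hQ]
    exact card_eigenSubgroup_le hη

/-! ### The maximum over separable states -/

theorem isCompact_unitVec (n : Type*) [Fintype n] :
    IsCompact {v : n → ℂ | ∑ s, ‖v s‖ ^ 2 = 1} := by
  refine (isCompact_closedBall (0 : n → ℂ) 1).of_isClosed_subset ?_ fun v hv => ?_
  · exact isClosed_eq (by fun_prop) continuous_const
  · rw [mem_closedBall_zero_iff, pi_norm_le_iff_of_nonneg zero_le_one]
    intro s
    have hv : ∑ s, ‖v s‖ ^ 2 = 1 := hv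
    have h : ‖v s‖ ^ 2 ≤ 1 := by
      rw [← hv]
      exact Finset.single_le_sum (f := fun s => ‖v s‖ ^ 2) (fun _ _ => by positivity)
        (Finset.mem_univ s)
    exact (sq_le_one_iff₀ (norm_nonneg _)).mp h

theorem trace_vecMulVec_mul_rho {Q : Finset (Phase d)} (hQ : Q.card = d) (φ ψ : ZMod d → ℂ) :
    (d : ℂ) * (Matrix.vecMulVec (prodVec d φ ψ) (star (prodVec d φ ψ)) * rho d Q).trace =
      ((∑ x ∈ Q, ‖amplitude x φ ψ‖ ^ 2 : ℝ) : ℂ) := by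
  rw [rho, Matrix.mul_smul, Matrix.trace_smul, hQ, smul_eq_mul, ← mul_assoc,
    mul_one_div_cancel dim_ne_zero, one_mul, Finset.mul_sum, Matrix.trace_sum, Complex.ofReal_sum]
  exact Finset.sum_congr rfl fun x _ => trace_bell_mul_vecMulVec x φ ψ

theorem convex_re_trace_mul_le (A : Op d) (m : ℝ) :
    Convex ℝ {σ : Op d | ((d : ℂ) * (σ * A).trace).re ≤ m} := by
  refine convex_halfSpace_le ⟨fun σ τ => ?_, fun c σ => ?_⟩ m
  · rw [add_mul, Matrix.trace_add, mul_add, Complex.add_re]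
  · rw [Matrix.smul_mul, Matrix.trace_smul, mul_smul_comm, Complex.smul_re]

theorem continuous_norm_sq_amplitude (x : Phase d) :
    Continuous fun p : (ZMod d → ℂ) × (ZMod d → ℂ) => ‖amplitude x p.1 p.2‖ ^ 2 := by
  have h : Continuous fun p : (ZMod d → ℂ) × (ZMod d → ℂ) =>
      ∑ y, star (bellVec d x) y * (p.1 y.1 * p.2 y.2) := by
    fun_prop
  exact h.norm.pow 2

/-- The expectation of `d ρ_Q` over the separable states is bounded by its value at some product
vector, since the unit vectors form a compact set. -/
theorem exists_maximizing_prodVec {Q : Finset (Phase d)} (hQ : Q.card = d) :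
    ∃ φ ψ : ZMod d → ℂ, star φ ⬝ᵥ φ = 1 ∧ star ψ ⬝ᵥ ψ = 1 ∧
      ∀ σ ∈ SEP d, ((d : ℂ) * (σ * rho d Q).trace).re ≤ ∑ x ∈ Q, ‖amplitude x φ ψ‖ ^ 2 := by
  have hcont : Continuous fun p : (ZMod d → ℂ) × (ZMod d → ℂ) =>
      ∑ x ∈ Q, ‖amplitude x p.1 p.2‖ ^ 2 :=
    continuous_finsetSum _ fun x _ => continuous_norm_sq_amplitude x
  have hS := isCompact_unitVec (ZMod d)
  have hne : ∑ s, ‖(Pi.single 0 1 : ZMod d → ℂ) s‖ ^ 2 = 1 := by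
    rw [sum_norm_sq_eq_one_iff]
    simp
  obtain ⟨⟨φ, ψ⟩, ⟨hφ, hψ⟩, hmax⟩ :=
    (hS.prod hS).exists_isMaxOn ⟨(_, _), hne, hne⟩ hcont.continuousOn
  refine ⟨φ, ψ, (sum_norm_sq_eq_one_iff φ).mp hφ, (sum_norm_sq_eq_one_iff ψ).mp hψ,
    fun σ hσ => ?_⟩
  refine convexHull_min ?_ (convex_re_trace_mul_le (rho d Q) _) hσ
  rintro _ ⟨φ', ψ', hφ', hψ', rfl⟩
  rw [Set.mem_ofPred_eq, trace_vecMulVec_mul_rho hQ, Complex.ofReal_re]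
  exact hmax (a := (φ', ψ')) ⟨hφ', hψ'⟩

/-- If `Q` is not a sublattice, then the expectation of `d ρ_Q` in separable states stays below a
bound smaller than `1`. -/
theorem exists_bound_lt_one {Q : Finset (Phase d)} (hQ : Q.card = d) (h : ¬ IsSublattice d Q) :
    ∃ m : ℝ, 0 ≤ m ∧ m < 1 ∧ ∀ σ ∈ SEP d, ((d : ℂ) * (σ * rho d Q).trace).re ≤ m := by
  obtain ⟨φ, ψ, hφ, hψ, hmax⟩ := exists_maximizing_prodVec hQ
  refine ⟨_, Finset.sum_nonneg fun _ _ => by positivity, ?_, hmax⟩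
  have h1 : ∑ _x ∈ Q, (1 / d : ℝ) = 1 := by
    rw [Finset.sum_const, hQ, nsmul_eq_mul, mul_one_div_cancel dim_pos.ne']
  rw [← h1]
  refine Finset.sum_lt_sum (fun x _ => norm_sq_amplitude_le x hφ hψ) ?_
  by_contra! hall
  exact h (isSublattice_of_amplitude hQ hφ hψ fun x hx =>
    le_antisymm (norm_sq_amplitude_le x hφ hψ) (hall x hx))

/-! ### Lines, sublattices and orbits -/

theorem IsLine.isSublattice {d : ℕ} {Q : Finset (Phase d)} (h : IsLine d Q) : IsSublattice d Q := by
  obtain ⟨p, q, k, l, hQ⟩ := h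
  refine ⟨(p, q), ((AddMonoidHom.mulRight k).prod (AddMonoidHom.mulRight l)).range, ?_⟩
  rw [hQ]
  ext y
  simp [Prod.ext_iff]

theorem isLine_or_isSublattice_iff {d : ℕ} {Q : Finset (Phase d)} :
    IsLine d Q ∨ IsSublattice d Q ↔ IsSublattice d Q :=
  ⟨fun h => h.elim IsLine.isSublattice id, Or.inr⟩

theorem card_of_translate {d : ℕ} {Q : Finset (Phase d)} {x : Phase d}
    {H : AddSubgroup (Phase d)} (h : (Q : Set (Phase d)) = {y | ∃ z ∈ H, y = x + z}) : Nat.card H = Q.card := by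
  rw [← Set.ncard_coe_finset, h, translate_eq_image,
    Set.ncard_image_of_injective _ (add_right_injective x)]
  rfl

theorem IsSublattice.rho_mem_SEP {Q : Finset (Phase d)} (hQ : Q.card = d)
    (h : IsSublattice d Q) : rho d Q ∈ SEP d := by
  obtain ⟨x, H, hQH⟩ := h
  refine rho_mem_SEP_of_translate hQ ((card_of_translate hQH).trans hQ) (x₀ := x) fun y hy => ?_
  have : y ∈ (Q : Set (Phase d)) := hy
  rwa [hQH] at this

/-- The coordinate axis is a sublattice with `d` points. -/
theorem exists_isSublattice : ∃ Q : Finset (Phase d), Q.card = d ∧ IsSublattice d Q := by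
  refine ⟨Finset.univ.map ⟨fun n : ZMod d => (0, n), Prod.mk_right_injective 0⟩, ?_,
    IsLine.isSublattice ⟨0, 0, 0, 1, ?_⟩⟩
  · rw [Finset.card_map, Finset.card_univ, ZMod.card]
  · ext y
    simp [Prod.ext_iff, eq_comm]

theorem norm_phase (j : ZMod d) : ‖phase d j‖ = 1 := AddChar.norm_apply _ _

theorem weyl_mulVec_bellVec (k l : ZMod d) (x : Phase d) :
    weyl d k l *ᵥ bellVec d x = phase d (x.1 * l) • bellVec d (x + (k, l)) := by
  rw [bellVec, bellVec, Matrix.mulVec_mulVec, weyl_mul, Matrix.smul_mulVec, Prod.fst_add,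
    Prod.snd_add, add_comm k, add_comm l]

/-- A Heisenberg-Weyl operator translates the Bell states. -/
theorem smul_weyl_mul_bell_mul_conjTranspose (m k l : ZMod d) (x : Phase d) :
    phase d m • weyl d k l * bell d x * (phase d m • weyl d k l)ᴴ = bell d (x + (k, l)) := by
  rw [bell, Matrix.mul_vecMulVec, Matrix.vecMulVec_mul, ← Matrix.star_mulVec, Matrix.smul_mulVec,
    weyl_mulVec_bellVec, vecMulVec_smul_star_smul, vecMulVec_smul_star_smul, norm_phase, norm_phase]
  simp [bell]

theorem smul_weyl_mem_unitaryGroup (m k l : ZMod d) :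
    phase d m • weyl d k l ∈ Matrix.unitaryGroup (ZMod d × ZMod d) ℂ := by
  rw [Matrix.mem_unitaryGroup_iff, Matrix.star_eq_conjTranspose, Matrix.conjTranspose_smul,
    weyl_conjTranspose, star_phase, Matrix.smul_mul, Matrix.mul_smul, Matrix.mul_smul, weyl_mul,
    smul_smul, smul_smul, smul_smul, ← phase_add, ← phase_add, ← phase_add]
  simp [weyl_zero, phase_zero]

/-- The Heisenberg-Weyl operators `w ^ m W_{k,l}` with `(k, l)` in a given subgroup. -/
def weylSubgroup (H : AddSubgroup (Phase d)) :
    Subgroup (Matrix.unitaryGroup (ZMod d × ZMod d) ℂ) where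
  carrier := {g | ∃ m k l : ZMod d, (k, l) ∈ H ∧ (g : Op d) = phase d m • weyl d k l}
  mul_mem' := by
    rintro a b ⟨m, k, l, hH, ha⟩ ⟨m', k', l', hH', hb⟩
    refine ⟨m + m' + k' * l, k + k', l + l', H.add_mem hH hH', ?_⟩
    rw [Matrix.UnitaryGroup.mul_val, ha, hb, Matrix.smul_mul, Matrix.mul_smul, weyl_mul,
      smul_smul, smul_smul, phase_add, phase_add, mul_assoc]
  one_mem' := ⟨0, 0, 0, H.zero_mem, by rw [phase_zero, weyl_zero, one_smul]; rfl⟩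
  inv_mem' := by
    rintro a ⟨m, k, l, hH, ha⟩
    refine ⟨-m + k * l, -k, -l, H.neg_mem hH, ?_⟩
    rw [Matrix.UnitaryGroup.inv_val, ha, Matrix.star_eq_conjTranspose, Matrix.conjTranspose_smul,
      weyl_conjTranspose, star_phase, smul_smul, phase_add]

/-- The translations of the phase space that a group of operators induces. -/
def translations (G : Subgroup (Matrix.unitaryGroup (ZMod d × ZMod d) ℂ)) :
    AddSubgroup (Phase d) where
  carrier := {x | ∃ g ∈ G, ∃ m : ZMod d, (g : Op d) = phase d m • weyl d x.1 x.2}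
  add_mem' := by
    rintro x y ⟨a, haG, m, ha⟩ ⟨b, hbG, m', hb⟩
    refine ⟨a * b, G.mul_mem haG hbG, m + m' + y.1 * x.2, ?_⟩
    rw [Matrix.UnitaryGroup.mul_val, ha, hb, Matrix.smul_mul, Matrix.mul_smul, weyl_mul,
      smul_smul, smul_smul, phase_add, phase_add, mul_assoc]
    rfl
  zero_mem' := ⟨1, G.one_mem, 0, by
    rw [Prod.fst_zero, Prod.snd_zero, phase_zero, weyl_zero, one_smul]; rfl⟩
  neg_mem' := by
    rintro x ⟨a, haG, m, ha⟩
    refine ⟨a⁻¹, G.inv_mem haG, -m + x.1 * x.2, ?_⟩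
    rw [Matrix.UnitaryGroup.inv_val, ha, Matrix.star_eq_conjTranspose, Matrix.conjTranspose_smul,
      weyl_conjTranspose, star_phase, smul_smul, phase_add]
    rfl

theorem orbit_weylSubgroup (H : AddSubgroup (Phase d)) (x : Phase d) :
    orbit d (weylSubgroup H) x = {y | ∃ z ∈ H, y = x + z} := by
  ext y
  constructor
  · rintro ⟨g, ⟨m, k, l, hH, hg⟩, h⟩
    rw [hg, smul_weyl_mul_bell_mul_conjTranspose] at h
    exact ⟨(k, l), hH, (bell_injective h).symm⟩
  · rintro ⟨z, hz, rfl⟩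
    exact ⟨⟨_, smul_weyl_mem_unitaryGroup 0 z.1 z.2⟩, ⟨0, z.1, z.2, hz, rfl⟩,
      smul_weyl_mul_bell_mul_conjTranspose 0 z.1 z.2 x⟩

theorem orbit_eq_of_le_heisenbergWeyl {G : Subgroup (Matrix.unitaryGroup (ZMod d × ZMod d) ℂ)}
    (hG : G ≤ heisenbergWeyl d) (x : Phase d) :
    orbit d G x = {y | ∃ z ∈ translations G, y = x + z} := by
  ext y
  constructor
  · rintro ⟨g, hg, h⟩
    obtain ⟨m, k, l, hgm⟩ := hG hg
    rw [hgm, smul_weyl_mul_bell_mul_conjTranspose] at h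
    exact ⟨(k, l), ⟨g, hg, m, hgm⟩, (bell_injective h).symm⟩
  · rintro ⟨z, ⟨g, hg, m, hgm⟩, rfl⟩
    refine ⟨g, hg, ?_⟩
    rw [hgm]
    exact smul_weyl_mul_bell_mul_conjTranspose m z.1 z.2 x

theorem isSublattice_iff_isGeneratedByAbelian {Q : Finset (Phase d)} (hQ : Q.card = d) :
    IsSublattice d Q ↔ IsGeneratedByAbelian d Q := by
  constructor
  · rintro ⟨x, H, h⟩
    have hH : Nat.card H = d := (card_of_translate h).trans hQ
    refine ⟨x, weylSubgroup H, ?_, ?_, h.trans (orbit_weylSubgroup H x).symm⟩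
    · rintro g ⟨m, k, l, -, hg⟩
      exact ⟨m, k, l, hg⟩
    · rintro g ⟨m, k, l, hkl, hg⟩ g' ⟨m', k', l', hkl', hg'⟩
      apply Subtype.ext
      have hsymp : k * l' = k' * l := symplectic_eq_zero hH hkl hkl'
      rw [Matrix.UnitaryGroup.mul_val, Matrix.UnitaryGroup.mul_val, hg, hg', Matrix.smul_mul,
        Matrix.mul_smul, Matrix.smul_mul, Matrix.mul_smul, weyl_mul, weyl_mul, hsymp, add_comm k',
        add_comm l', smul_comm (phase d m)]
  · rintro ⟨x, G, hG, -, h⟩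
    exact ⟨x, translations G, h.trans (orbit_eq_of_le_heisenbergWeyl hG x)⟩

/-! ### Witnesses -/

theorem trace_eq_one_of_mem_SEP {σ : Op d} (hσ : σ ∈ SEP d) : σ.trace = 1 := by
  have hconv : Convex ℝ {σ : Op d | σ.trace = 1} := by
    intro σ hσ τ hτ a b _ _ hab
    rw [Set.mem_ofPred_eq] at hσ hτ ⊢
    rw [Matrix.trace_add, Matrix.trace_smul, Matrix.trace_smul, hσ, hτ, ← add_smul, hab, one_smul]
  refine convexHull_min ?_ hconv hσ
  rintro _ ⟨φ, ψ, hφ, hψ, rfl⟩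
  rw [Set.mem_ofPred_eq, Matrix.trace_vecMulVec, dotProduct_comm]
  exact star_prodVec_dotProduct_self ((sum_norm_sq_eq_one_iff φ).mp hφ)
    ((sum_norm_sq_eq_one_iff ψ).mp hψ)

theorem trace_rho_mul_witness {Q : Finset (Phase d)} (hQ : Q.card = d) (ε : ℝ) :
    (rho d Q * (1 - ((1 + ε) * d : ℂ) • rho d Q : Op d)).trace = -(ε : ℂ) := by
  have hd := dim_ne_zero (d := d)
  rw [mul_sub, mul_one, Matrix.mul_smul, Matrix.trace_sub, Matrix.trace_smul, trace_rho hQ,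
    trace_rho_mul_self hQ, smul_eq_mul]
  push_cast
  field_simp
  ring

theorem witness_mem_structuralWitness {Q : Finset (Phase d)} (hQ : Q.card = d) {m ε : ℝ}
    (hm : ∀ σ ∈ SEP d, ((d : ℂ) * (σ * rho d Q).trace).re ≤ m) (hε : 0 < ε)
    (hεm : (1 + ε) * m ≤ 1) :
    (1 - ((1 + ε) * d : ℂ) • rho d Q : Op d) ∈ structuralWitness d := by
  refine ⟨?_, ?_, fun σ hσ => ?_⟩
  · have hρ : (rho d Q).IsHermitian :=
      (magicSimplex_subset_LMM (rho_mem_magicSimplex (nonempty_of_card_eq_dim hQ))).1.isHermitian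
    rw [Matrix.IsHermitian, Matrix.conjTranspose_sub, Matrix.conjTranspose_one,
      Matrix.conjTranspose_smul, hρ.eq]
    simp
  · intro h0
    have h := trace_rho_mul_witness hQ ε
    rw [h0, mul_zero, Matrix.trace_zero, eq_comm, neg_eq_zero] at h
    exact hε.ne' (by exact_mod_cast h)
  · have h : ((1 + ε) * d : ℂ) * (σ * rho d Q).trace =
        ((1 + ε : ℝ) : ℂ) * ((d : ℂ) * (σ * rho d Q).trace) := by
      push_cast
      ring
    rw [mul_sub, mul_one, Matrix.mul_smul, Matrix.trace_sub, Matrix.trace_smul,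
      trace_eq_one_of_mem_SEP hσ, smul_eq_mul, h, Complex.sub_re, Complex.re_ofReal_mul,
      Complex.one_re]
    have := mul_le_mul_of_nonneg_left (hm σ hσ) (by linarith : (0 : ℝ) ≤ 1 + ε)
    linarith

theorem rho_notMem_SEP {Q : Finset (Phase d)} (hQ : Q.card = d) (h : ¬ IsSublattice d Q) :
    rho d Q ∉ SEP d := by
  intro hS
  obtain ⟨m, -, hm1, hm⟩ := exists_bound_lt_one hQ h
  have h1 := hm _ hS
  rw [trace_rho_mul_self hQ] at h1
  push_cast at h1
  rw [mul_one_div_cancel dim_ne_zero, Complex.one_re] at h1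
  linarith

/-! ### Maximally exposed states -/

/-- In a set of locally maximally mixed separable states which contains a state of purity `1 / d`,
the maximally exposed states are those of purity at least `1 / d`. -/
theorem mem_maximallyExposed_iff {S : Set (Op d)} (hS : S ⊆ SEP d ∩ LMM d) {τ : Op d} (hτ : τ ∈ S)
    (hτ' : (τ * τ).trace.re = 1 / d) (σ : Op d) :
    σ ∈ maximallyExposed d S ↔ σ ∈ S ∧ 1 / (d : ℝ) ≤ (σ * σ).trace.re := by
  constructor
  · rintro ⟨hσ, hmax⟩
    have h := hmax τ hτ
    rw [hsDist_maxMixed (hS hτ).2.2.1, hsDist_maxMixed (hS hσ).2.2.1, hτ',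
      Real.sqrt_le_sqrt_iff (sub_nonneg.mpr (inv_dim_sq_le_purity (hS hσ).2))] at h
    exact ⟨hσ, by linarith⟩
  · rintro ⟨hσ, hle⟩
    refine ⟨hσ, fun υ hυ => ?_⟩
    rw [hsDist_maxMixed (hS hυ).2.2.1, hsDist_maxMixed (hS hσ).2.2.1]
    exact Real.sqrt_le_sqrt (sub_le_sub_right ((purity_le (hS hυ).1 (hS hυ).2).trans hle) _)

theorem mem_maximallyExposed_magicSimplex_iff (σ : Op d) :
    σ ∈ maximallyExposed d (SEP d ∩ magicSimplex d) ↔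
      σ ∈ SEP d ∩ magicSimplex d ∧ 1 / (d : ℝ) ≤ (σ * σ).trace.re := by
  obtain ⟨Q, hQ, hsub⟩ := exists_isSublattice (d := d)
  exact mem_maximallyExposed_iff (Set.inter_subset_inter_right _ magicSimplex_subset_LMM)
    ⟨hsub.rho_mem_SEP hQ, rho_mem_magicSimplex (nonempty_of_card_eq_dim hQ)⟩
    (by rw [trace_rho_mul_self hQ, Complex.ofReal_re]) σ

theorem mem_maximallyExposed_LMM_iff (σ : Op d) :
    σ ∈ maximallyExposed d (SEP d ∩ LMM d) ↔
      σ ∈ SEP d ∩ LMM d ∧ 1 / (d : ℝ) ≤ (σ * σ).trace.re := by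
  obtain ⟨Q, hQ, hsub⟩ := exists_isSublattice (d := d)
  exact mem_maximallyExposed_iff subset_rfl ⟨hsub.rho_mem_SEP hQ,
    magicSimplex_subset_LMM (rho_mem_magicSimplex (nonempty_of_card_eq_dim hQ))⟩
    (by rw [trace_rho_mul_self hQ, Complex.ofReal_re]) σ

theorem bijOn_rho : Set.BijOn (rho d) (linesAndSublattices d)
    (maximallyExposed d (SEP d ∩ magicSimplex d)) := by
  refine ⟨?_, rho_injOn.mono fun Q hQ => hQ.1, ?_⟩
  · rintro Q ⟨hQ, hQ'⟩
    rw [isLine_or_isSublattice_iff] at hQ'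
    rw [mem_maximallyExposed_magicSimplex_iff, trace_rho_mul_self hQ, Complex.ofReal_re]
    exact ⟨⟨hQ'.rho_mem_SEP hQ, rho_mem_magicSimplex (nonempty_of_card_eq_dim hQ)⟩, le_rfl⟩
  · intro σ hσ
    rw [mem_maximallyExposed_magicSimplex_iff] at hσ
    obtain ⟨Q, hQ, rfl⟩ := exists_eq_rho_of_purity hσ.1.1 hσ.1.2 hσ.2
    refine ⟨Q, ⟨hQ, isLine_or_isSublattice_iff.mpr ?_⟩, rfl⟩
    by_contra h
    exact rho_notMem_SEP hQ h hσ.1.1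

end MagicSimplex

theorem theorem7p1 (d : ℕ) [NeZero d] :
    Set.BijOn (MagicSimplex.rho d) (MagicSimplex.linesAndSublattices d)
      (MagicSimplex.maximallyExposed d (MagicSimplex.SEP d ∩ MagicSimplex.magicSimplex d)) ∧
    MagicSimplex.maximallyExposed d (MagicSimplex.SEP d ∩ MagicSimplex.magicSimplex d) =
      MagicSimplex.maximallyExposed d (MagicSimplex.SEP d ∩ MagicSimplex.LMM d) ∩
        MagicSimplex.magicSimplex d ∧
    (∀ Q : Finset (MagicSimplex.Phase d), Q.card = d →
      (MagicSimplex.IsLine d Q ∨ MagicSimplex.IsSublattice d Q ↔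
        MagicSimplex.IsGeneratedByAbelian d Q)) ∧
    (∀ Q : Finset (MagicSimplex.Phase d), Q.card = d → Q ∉ MagicSimplex.linesAndSublattices d →
      (∃ ε₀ : ℝ, 0 < ε₀ ∧ ∀ ε : ℝ, 0 < ε → ε ≤ ε₀ →
        (1 - ((1 + ε) * d : ℂ) • MagicSimplex.rho d Q : MagicSimplex.Op d) ∈
            MagicSimplex.structuralWitness d ∧
          (MagicSimplex.rho d Q *
            (1 - ((1 + ε) * d : ℂ) • MagicSimplex.rho d Q : MagicSimplex.Op d)).trace = -(ε : ℂ)) ∧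
      MagicSimplex.rho d Q ∉ MagicSimplex.SEP d) := by
  open MagicSimplex in
  refine ⟨bijOn_rho, ?_, ?_, ?_⟩
  · ext σ
    rw [Set.mem_inter_iff, mem_maximallyExposed_magicSimplex_iff, mem_maximallyExposed_LMM_iff]
    exact ⟨fun h => ⟨⟨⟨h.1.1, magicSimplex_subset_LMM h.1.2⟩, h.2⟩, h.1.2⟩,
      fun h => ⟨⟨h.1.1.1, h.2⟩, h.1.2⟩⟩
  · intro Q hQ
    rw [isLine_or_isSublattice_iff, isSublattice_iff_isGeneratedByAbelian hQ]
  · intro Q hQ hQ'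
    have h : ¬ IsSublattice d Q := fun h => hQ' ⟨hQ, Or.inr h⟩
    obtain ⟨m, hm0, hm1, hm⟩ := exists_bound_lt_one hQ h
    refine ⟨⟨1 - m, sub_pos.mpr hm1, fun ε hε hεm => ⟨?_, trace_rho_mul_witness hQ ε⟩⟩,
      rho_notMem_SEP hQ h⟩
    -- `(1 + ε) m ≤ (2 - m) m = 1 - (1 - m) ^ 2`
    exact witness_mem_structuralWitness hQ hm hε (by nlinarith [sq_nonneg (1 - m)])
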